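/- Let $\mathbb{K}$ be a field of characteristic $0$; all spaces are $\mathbb{Z}$-graded $\mathbb{K}$-vector spaces, and $\epsilon(\sigma)$ denotes the Koszul sign, $v_{\sigma(1)}\odot\cdots\odot v_{\sigma(k)}=\epsilon(\sigma)\,v_1\odot\cdots\odot v_k$. Let $(A,\{\mu_k\}_{k\ge1})$ be an $A_\infty[1]$-algebra, i.e. the $\mu_k:A^{\otimes k}\to A$ have degree $1$ and $$\sum_{i+j=n+1}\sum_{\lambda=1}^{j}(-1)^{|a_1|+\cdots+|a_{\lambda-1}|}\mu_j(a_1,\ldots,a_{\lambda-1},\mu_i(a_\lambda,\ldots,a_{\lambda+i-1}),a_{\lambda+i},\ldots,a_n)=0\qquad(n\ge1).$$ Let $(M,\{\eta_k\}_{k\ge1})$ be a bimodule over it: the $\eta_k$ are degree $1$ maps to $M$ from the $k$-fold tensor products of $A$'s and $M$'s in which $M$ appears exactly once, and the same identities hold when exactly one argument is from $M$, with $\eta$ in place of $\mu$ where an argument is from $M$. Let $T:M\to A$ be a strict homotopy relative Rota-Baxter operator: $T$ is linear of degree $0$ and, as an element of $\mathrm{Hom}(\overline T(M),A)$ concentrated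 in arity one, satisfies the Maurer-Cartan equation $\sum_{n\ge1}\frac1{n!}P[\cdots[[\Delta,T],T],\cdots,T]=0$ ($n$ copies of $T$ in the $n$-th term), where $\Delta=\sum_k(\mu_k+\eta_k)$, $[\,,]$ is the Gerstenhaber bracket on $\mathrm{Hom}(\overline T(A\oplus M),A\oplus M)$ and $P$ is the projection to $\mathrm{Hom}(\overline T(M),A)$. Then: 1. The maps $\mu_{k,[r]}(u_1,\ldots,u_k)=\eta_k(Tu_1,\ldots,Tu_{r-1},u_r,Tu_{r+1},\ldots,Tu_k)$, $1\le r\le k$, make $M$ a $Dend_\infty[1]$-algebra, and the maps $$\theta_k(u_1,\ldots,u_k)=\sum_{\sigma\in S_k}\epsilon(\sigma)\,\mu_{k,[\sigma^{-1}(k)]}(u_{\sigma(1)},\ldots,u_{\sigma(k)})$$ obtained from it make $M$ a $pre\text{-}Lie_\infty[1]$-algebra. 2. The symmetrizations $l_k(a_1,\ldots,a_k)=\sum_{\sigma\in S_k}\epsilon(\sigma)\mu_k(a_{\sigma(1)},\ldots,a_{\sigma(k)})$ make $A$ an $L_\infty[1]$-algebra, and $\rho_k(a_1,\ldots,a_k)=\sum_{\sigma\in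 S_k}\epsilon(\sigma)\eta_k(a_{\sigma(1)},\ldots,a_{\sigma(k)})$ (exactly one argument from $M$) make $M$ a module over it. $T$ is a strict homotopy relative Rota-Baxter operator on the module $(M,\{\rho_k\})$ over $(A,\{l_k\})$, i.e. it satisfies the analogous Maurer-Cartan equation with $\Delta=\sum_k(l_k+\rho_k)$ and the Nijenhuis-Richardson bracket on $\mathrm{Hom}(\overline S(A\oplus M),A\oplus M)$. The induced maps $$\theta'_k(u_1,\ldots,u_k)=\rho_k(Tu_1,\ldots,Tu_{k-1},u_k)$$ make $M$ a $pre\text{-}Lie_\infty[1]$-algebra. 3. The two $pre\text{-}Lie_\infty[1]$-structures coincide: $\theta_k=\theta'_k$ for all $k\ge1$. Here a $pre\text{-}Lie_\infty[1]$-structure is a family of degree $1$ maps $\theta_k$, graded symmetric in the first $k-1$ arguments, with, for all $n\ge1$, $$\sum_{\substack{i+j=n+1\\ j\ge2}}\ \sum_{\sigma\in S_{(i-1,1,j-2)}}\epsilon(\sigma)\,\theta_j(\theta_i(x_{\sigma(1)},\ldots,x_{\sigma(i)}),x_{\sigma(i+1)},\ldots,x_{\sigma(n-1)},x_n)$$ $$+\sum_{i+j=n+1}\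 \sum_{\sigma\in S_{(j-1,i-1)}}(-1)^{|x_{\sigma(1)}|+\cdots+|x_{\sigma(j-1)}|}\epsilon(\sigma)\,\theta_j(x_{\sigma(1)},\ldots,x_{\sigma(j-1)},\theta_i(x_{\sigma(j)},\ldots,x_{\sigma(n-1)},x_n))=0,$$ the shuffles permuting $\{1,\ldots,n-1\}$. A $Dend_\infty[1]$-structure is a family of degree $1$ maps $\mu_{k,[r]}$, $1\le r\le k$, such that for all $n\ge 1$ and $1\le r\le n$ $$\sum_{k+l=n+1}\sum_{i=1}^{k}(-1)^{|a_1|+\cdots+|a_{i-1}|}\mu_{k,R_0[r]}(a_1,\ldots,a_{i-1},\mu_{l,R_i[r]}(a_i,\ldots,a_{i+l-1}),a_{i+l},\ldots,a_n)=0,$$ where $(R_0[r],R_i[r])$ is $([r],[1]+\cdots+[l])$ if $r<i$, $([i],[r-i+1])$ if $i\le r\le i+l-1$, and $([r-l+1],[1]+\cdots+[l])$ if $r\ge i+l$; a sum as an index denotes the sum of the corresponding maps. $L_\infty[1]$-algebras have graded symmetric degree $1$ brackets satisfying $\sum_{i+j=n+1}\sum_{\sigma\in S_{(i,n-i)}}\epsilon(\sigma)l_j(l_i(x_{\sigma(1)},\ldots,x_{\sigma(i)}),x_{\sigma(i+1)},\ldots,x_{\sigma(n)})=0$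 for all $n\ge1$, and modules satisfy these identities with exactly one argument from the module. -/

import Mathlib

open scoped DirectSum

noncomputable section

namespace HomotopyRB

section Graded

variable {K : Type*} [Field K] {V : Type*} [AddCommGroup V] [Module K V]

/-- A family of multilinear maps `V^{⊗ n} → W`, `n ≥ 1`.
The member with index `k` has arity `k + 1`. -/
abbrev Ops (K V W : Type*) [Field K] [AddCommGroup V] [Module K V] [AddCommGroup W] [Module K W] :=
  (k : ℕ) → MultilinearMap K (fun _ : Fin (k + 1) => V) W

/-- Underlying maps of a family of operations of all arities `≥ 1` on `V`; index `k` is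
arity `k + 1`. -/
abbrev Fam (V : Type*) := (k : ℕ) → (Fin (k + 1) → V) → V

/-- A multilinear map between `ℤ`-graded spaces is homogeneous of degree `n`. -/
def HasDegree {W : Type*} [AddCommGroup W] [Module K W] (𝒱 : ℤ → Submodule K V)
    (𝒲 : ℤ → Submodule K W) (n : ℤ) {k : ℕ}
    (f : MultilinearMap K (fun _ : Fin k => V) W) : Prop :=
  ∀ (d : Fin k → ℤ) (x : Fin k → V), (∀ i, x i ∈ 𝒱 (d i)) → f x ∈ 𝒲 ((∑ i, d i) + n)

/-- The Koszul sign `ε(σ; v_1, …, v_k)` for elements `v_i` of parity `p i`, determined by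
`v_{σ(1)} ⊙ ⋯ ⊙ v_{σ(k)} = ε(σ) v_1 ⊙ ⋯ ⊙ v_k`: every inversion of `σ` between two odd elements
contributes a factor `-1`. -/
def koszulSign {k : ℕ} (σ : Equiv.Perm (Fin k)) (p : Fin k → ZMod 2) : ℤ :=
  ∏ i, ∏ j, if i < j ∧ σ j < σ i ∧ p (σ i) = 1 ∧ p (σ j) = 1 then -1 else 1

variable (𝒱 : ℤ → Submodule K V) [DirectSum.Decomposition 𝒱]

/-- The linear operator acting on the degree `i` component by `(-1)^{n i}`. -/
def sgn (n : ℤ) : V →ₗ[K] V :=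
  DirectSum.toModule K ℤ V (fun i => ((n * i).negOnePow : ℤ) • (𝒱 i).subtype) ∘ₗ
    (DirectSum.decomposeLinearEquiv 𝒱).toLinearMap

/-- The projection of `V` to the sum of its components whose degree has parity `p`. -/
def parityPart (p : ZMod 2) : V →ₗ[K] V :=
  DirectSum.toModule K ℤ V (fun i => if (i : ZMod 2) = p then (𝒱 i).subtype else 0) ∘ₗ
    (DirectSum.decomposeLinearEquiv 𝒱).toLinearMap

theorem sgn_of_mem (n : ℤ) {i : ℤ} {v : V} (hv : v ∈ 𝒱 i) :
    sgn 𝒱 n v = ((n * i).negOnePow : ℤ) • v := by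
  simp only [sgn, LinearMap.comp_apply, LinearEquiv.coe_coe, DirectSum.decomposeLinearEquiv_apply,
    DirectSum.decompose_of_mem 𝒱 hv]
  erw [DirectSum.toModule_lof]
  simp

theorem parityPart_of_mem (p : ZMod 2) {i : ℤ} {v : V} (hv : v ∈ 𝒱 i) :
    parityPart 𝒱 p v = if (i : ZMod 2) = p then v else 0 := by
  simp only [parityPart, LinearMap.comp_apply, LinearEquiv.coe_coe,
    DirectSum.decomposeLinearEquiv_apply, DirectSum.decompose_of_mem 𝒱 hv]
  erw [DirectSum.toModule_lof]
  split_ifs <;> simp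

/-- The graded sum `∑_σ ε(σ; x) F_σ (x_{σ(1)}, …, x_{σ(k)})`, for multilinear `F_σ`. The Koszul
sign depends only on the parities of the arguments, so the formula is extended from homogeneous
to arbitrary tuples by splitting each argument into its even and its odd part. -/
def koszulSum {W : Type*} [AddCommGroup W] {k : ℕ}
    (F : Equiv.Perm (Fin k) → (Fin k → V) → W) (x : Fin k → V) : W :=
  ∑ p : Fin k → ZMod 2, ∑ σ : Equiv.Perm (Fin k),
    koszulSign σ p • F σ (fun i => parityPart 𝒱 (p (σ i)) (x (σ i)))

/-- On homogeneous arguments `koszulSum` is the expected sum over permutations. -/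
theorem koszulSum_of_mem {W : Type*} [AddCommGroup W] {k : ℕ}
    (F : Equiv.Perm (Fin k) → (Fin k → V) → W) (hF : ∀ σ y i, y i = 0 → F σ y = 0)
    (d : Fin k → ℤ) (x : Fin k → V) (hx : ∀ i, x i ∈ 𝒱 (d i)) :
    koszulSum 𝒱 F x =
      ∑ σ : Equiv.Perm (Fin k), koszulSign σ (fun i => (d i : ZMod 2)) • F σ (fun i => x (σ i)) := by
  unfold koszulSum
  rw [Finset.sum_eq_single (fun i => (d i : ZMod 2))]
  · refine Finset.sum_congr rfl fun σ _ => ?_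
    congr 2
    funext i
    rw [parityPart_of_mem 𝒱 _ (hx (σ i)), if_pos rfl]
  · intro p _ hp
    obtain ⟨j, hj⟩ := Function.ne_iff.mp hp
    refine Finset.sum_eq_zero fun σ _ => ?_
    rw [hF σ _ (σ.symm j), smul_zero]
    rw [Equiv.apply_symm_apply, parityPart_of_mem 𝒱 _ (hx j), if_neg (Ne.symm hj)]
  · simp

/-- `koszulSum` of a family of multilinear maps, as a multilinear map. -/
def koszulSumMap {W : Type*} [AddCommGroup W] [Module K W] {k : ℕ}
    (f : Equiv.Perm (Fin k) → MultilinearMap K (fun _ : Fin k => V) W) :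
    MultilinearMap K (fun _ : Fin k => V) W :=
  ∑ p : Fin k → ZMod 2, ∑ σ : Equiv.Perm (Fin k),
    koszulSign σ p •
      ((f σ).compLinearMap (fun i => parityPart 𝒱 (p (σ i)))).domDomCongr σ

theorem koszulSumMap_apply {W : Type*} [AddCommGroup W] [Module K W] {k : ℕ}
    (f : Equiv.Perm (Fin k) → MultilinearMap K (fun _ : Fin k => V) W) (x : Fin k → V) :
    koszulSumMap 𝒱 f x = koszulSum 𝒱 (fun σ y => f σ y) x := by
  simp [koszulSumMap, koszulSum]

/-- Graded symmetry: `f(x_{σ(1)}, …, x_{σ(k)}) = ε(σ) f(x_1, …, x_k)` for homogeneous `x_i`. -/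
def IsGradedSymm {W : Type*} [AddCommGroup W] [Module K W] {k : ℕ}
    (f : MultilinearMap K (fun _ : Fin k => V) W) : Prop :=
  ∀ (σ : Equiv.Perm (Fin k)) (d : Fin k → ℤ) (x : Fin k → V), (∀ i, x i ∈ 𝒱 (d i)) →
    f (fun i => x (σ i)) = koszulSign σ (fun i => (d i : ZMod 2)) • f x

/-- Symmetrization `(x_1, …, x_k) ↦ ∑_σ ε(σ) f_k(x_{σ(1)}, …, x_{σ(k)})` of all operations. -/
def symmetrize {W : Type*} [AddCommGroup W] [Module K W] (f : Ops K V W) : Ops K V W :=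
  fun k => koszulSumMap 𝒱 (fun _ => f k)

end Graded

section Brackets

variable {K : Type*} [Field K] {V : Type*} [AddCommGroup V] [Module K V]

/-- For `N = k + l` and `x = (x_0, …, x_N)`, the `k + 1` arguments
`(s x_0, …, s x_{i-1}, g(x_i, …, x_{i+l}), x_{i+l+1}, …, x_N)`.
All indices fed to `Fin.ofNat` are at most `N`. -/
def insertAt (s : V → V) (k l N i : ℕ) (g : (Fin (l + 1) → V) → V) (x : Fin (N + 1) → V) :
    Fin (k + 1) → V :=
  fun q =>
    if q.val < i then s (x (Fin.ofNat (N + 1) q.val))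
    else if q.val = i then g (fun r => x (Fin.ofNat (N + 1) (i + r.val)))
    else x (Fin.ofNat (N + 1) (q.val + l))

variable (𝒱 : ℤ → Submodule K V) [DirectSum.Decomposition 𝒱]

/-- The circle product `f ∘ g` on `Hom(T̄ V, V)`, for `g` of degree `n`:
`∑ (-1)^{n(|x_1| + ⋯ + |x_{i-1}|)} f(x_1, …, x_{i-1}, g(x_i, …), …)`. -/
def circ (n : ℤ) (f g : Fam V) : Fam V := fun N x =>
  ∑ kl ∈ Finset.HasAntidiagonal.antidiagonal N, ∑ i : Fin (kl.1 + 1),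
    f kl.1 (insertAt (sgn 𝒱 n) kl.1 kl.2 N i.val (g kl.2) x)

/-- The graded Lie (Gerstenhaber) bracket on `Hom(T̄ V, V)`, for `f` of degree `m` and `g` of
degree `n`. -/
def bracket (m n : ℤ) (f g : Fam V) : Fam V := fun N x =>
  circ 𝒱 n f g N x - ((m * n).negOnePow : ℤ) • circ 𝒱 m g f N x

/-- `(m, n - m)`-shuffles (positions are counted from `0`). -/
def IsShuffle (m : ℕ) {n : ℕ} (σ : Equiv.Perm (Fin n)) : Prop :=
  ∀ i j : Fin n, i < j → (j.val < m ∨ m ≤ i.val) → σ i < σ j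

open Classical in
/-- The circle product on `Hom(S̄ V, V)`:
`∑_{k+l=N} ∑_{σ ∈ S_{(l+1,k)}} ε(σ) f(g(x_{σ(1)}, …, x_{σ(l+1)}), x_{σ(l+2)}, …)`. -/
def symmCirc (f g : Fam V) : Fam V := fun N x =>
  ∑ kl ∈ Finset.HasAntidiagonal.antidiagonal N,
    koszulSum 𝒱 (fun σ y =>
      if IsShuffle (kl.2 + 1) σ then f kl.1 (insertAt id kl.1 kl.2 N 0 (g kl.2) y) else 0) x

/-- The Nijenhuis-Richardson bracket on `Hom(S̄ V, V)`, for `f` of degree `m` and `g` of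
degree `n`. -/
def symmBracket (m n : ℤ) (f g : Fam V) : Fam V := fun N x =>
  symmCirc 𝒱 f g N x - ((m * n).negOnePow : ℤ) • symmCirc 𝒱 g f N x

end Brackets

section Pairs

variable {K : Type*} [Field K] {A M : Type*} [AddCommGroup A] [Module K A]
  [AddCommGroup M] [Module K M]

/-- The grading of the direct sum `A ⊕ M`. -/
def prodGrading (𝒜 : ℤ → Submodule K A) (ℳ : ℤ → Submodule K M) : ℤ → Submodule K (A × M) :=
  fun i => (𝒜 i).prod (ℳ i)

instance prodGradingDecomposition (𝒜 : ℤ → Submodule K A) [DirectSum.Decomposition 𝒜]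
    (ℳ : ℤ → Submodule K M) [DirectSum.Decomposition ℳ] :
    DirectSum.Decomposition (prodGrading 𝒜 ℳ) := by
  let incA : (i : ℤ) → 𝒜 i →ₗ[K] prodGrading 𝒜 ℳ i := fun i =>
    LinearMap.codRestrict _ (LinearMap.inl K A M ∘ₗ (𝒜 i).subtype)
      (fun a => ⟨a.2, (ℳ i).zero_mem⟩)
  let incM : (i : ℤ) → ℳ i →ₗ[K] prodGrading 𝒜 ℳ i := fun i =>
    LinearMap.codRestrict _ (LinearMap.inr K A M ∘ₗ (ℳ i).subtype)
      (fun m => ⟨(𝒜 i).zero_mem, m.2⟩)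
  let dA : A →ₗ[K] ⨁ i, prodGrading 𝒜 ℳ i :=
    DirectSum.toModule K ℤ _ (fun i => DirectSum.lof K ℤ (fun i => prodGrading 𝒜 ℳ i) i ∘ₗ incA i) ∘ₗ
      (DirectSum.decomposeLinearEquiv 𝒜).toLinearMap
  let dM : M →ₗ[K] ⨁ i, prodGrading 𝒜 ℳ i :=
    DirectSum.toModule K ℤ _ (fun i => DirectSum.lof K ℤ (fun i => prodGrading 𝒜 ℳ i) i ∘ₗ incM i) ∘ₗ
      (DirectSum.decomposeLinearEquiv ℳ).toLinearMap
  have hA : ∀ i (a : 𝒜 i), dA a = DirectSum.lof K ℤ (fun i => prodGrading 𝒜 ℳ i) i (incA i a) := by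
    intro i a
    simp only [dA, LinearMap.comp_apply, LinearEquiv.coe_coe,
      DirectSum.decomposeLinearEquiv_apply, DirectSum.decompose_coe]
    erw [DirectSum.toModule_lof]
    rfl
  have hM : ∀ i (m : ℳ i), dM m = DirectSum.lof K ℤ (fun i => prodGrading 𝒜 ℳ i) i (incM i m) := by
    intro i m
    simp only [dM, LinearMap.comp_apply, LinearEquiv.coe_coe,
      DirectSum.decomposeLinearEquiv_apply, DirectSum.decompose_coe]
    erw [DirectSum.toModule_lof]
    rfl
  refine DirectSum.Decomposition.ofLinearMap _ (LinearMap.coprod dA dM) ?_ ?_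
  · apply LinearMap.ext
    rintro ⟨a, m⟩
    have h1 : ∀ a : A, DirectSum.coeLinearMap (prodGrading 𝒜 ℳ) (dA a) = (a, 0) := by
      intro a
      induction a using DirectSum.Decomposition.inductionOn 𝒜 with
      | zero => simp only [map_zero]; rfl
      | homogeneous a => rw [hA, DirectSum.coeLinearMap_lof]; rfl
      | add a b ha hb => rw [map_add, map_add, ha, hb]; simp
    have h2 : ∀ m : M, DirectSum.coeLinearMap (prodGrading 𝒜 ℳ) (dM m) = (0, m) := by
      intro a
      induction a using DirectSum.Decomposition.inductionOn ℳ with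
      | zero => simp only [map_zero]; rfl
      | homogeneous a => rw [hM, DirectSum.coeLinearMap_lof]; rfl
      | add a b ha hb => rw [map_add, map_add, ha, hb]; simp
    simp [h1, h2]
  · apply DirectSum.linearMap_ext
    intro i
    apply LinearMap.ext
    rintro ⟨⟨a, m⟩, ha, hm⟩
    simp only [LinearMap.comp_apply, DirectSum.coeLinearMap_lof, LinearMap.coprod_apply,
      LinearMap.id_apply]
    have e1 := hA i ⟨a, ha⟩
    have e2 := hM i ⟨m, hm⟩
    simp only at e1 e2
    rw [e1, e2, ← map_add]
    congr 1
    refine Subtype.ext (Prod.ext ?_ ?_)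
    · change a + 0 = a
      exact add_zero a
    · change 0 + m = m
      exact zero_add m

/-- The sum `μ + η` of operations on `A` and mixed operations with values in `M`, as operations
on `A ⊕ M`. -/
def liftOps (μ : Ops K A A) (η : Ops K (A × M) M) : Fam (A × M) :=
  fun k x => (μ k (fun i => (x i).1), η k x)

/-- The family of maps `M^{⊗ k} → A`, regarded as operations on `A ⊕ M`. -/
def liftMap (T : Ops K M A) : Fam (A × M) := fun k x => (T k (fun i => (x i).2), 0)

/-- `η_k` vanishes on `k`-fold tensors of elements of `A` and of `M` in which the number of
elements of `M` is not exactly one: `η` is given by maps on the tensor powers of `A` and `M` in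
which `M` appears exactly once. -/
def IsLinearInM (η : Ops K (A × M) M) : Prop :=
  ∀ (k : ℕ) (S : Finset (Fin (k + 1))) (x : Fin (k + 1) → A × M),
    (∀ i ∈ S, (x i).1 = 0) → (∀ i ∉ S, (x i).2 = 0) → S.card ≠ 1 → η k x = 0

/-- Exactly one entry is taken from `M`, the others are taken from `A`. -/
def OneFromM {k : ℕ} (x : Fin k → A × M) : Prop :=
  ∃ r, (x r).1 = 0 ∧ ∀ i, i ≠ r → (x i).2 = 0

/-- The family with `T_1 = T` and all other components zero. -/
def strictFamily (T : M →ₗ[K] A) : Ops K M A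
  | 0 => MultilinearMap.ofSubsingleton K M A (0 : Fin 1) T
  | _ + 1 => 0

end Pairs

section Structures

variable {K : Type*} [Field K] {V : Type*} [AddCommGroup V] [Module K V]

/-- `A_∞[1]`-algebras. -/
structure IsAInfAlgebra (𝒱 : ℤ → Submodule K V) [DirectSum.Decomposition 𝒱]
    (μ : Ops K V V) : Prop where
  degree : ∀ k, HasDegree 𝒱 𝒱 1 (μ k)
  identity : ∀ N x, circ 𝒱 1 (fun k => μ k) (fun k => μ k) N x = 0

/-- `L_∞[1]`-algebras. -/
structure IsLInfAlgebra (𝒱 : ℤ → Submodule K V) [DirectSum.Decomposition 𝒱]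
    (l : Ops K V V) : Prop where
  degree : ∀ k, HasDegree 𝒱 𝒱 1 (l k)
  symm : ∀ k, IsGradedSymm 𝒱 (l k)
  identity : ∀ N x, symmCirc 𝒱 (fun k => l k) (fun k => l k) N x = 0

/-- Families of operations `μ_{k,[r]}`; `D k r` is `μ_{k+1,[r+1]}`. -/
abbrev DendOps (K V : Type*) [Field K] [AddCommGroup V] [Module K V] :=
  (k : ℕ) → Fin (k + 1) → MultilinearMap K (fun _ : Fin (k + 1) => V) V

/-- The component `[r]` (counted from `0`) of the circle product `D ∘ D` for `D` of degree `1`: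
`∑ (-1)^{|x_1| + ⋯ + |x_{i-1}|} D_{R_0[r]}(x_1, …, x_{i-1}, D_{R_i[r]}(x_i, …), …)`.
If `r` lies in the inner block `i, …, i + l`, then `R_0[r] = [i]` and `R_i[r] = [r - i]`;
otherwise `R_0[r]` is the position of `r` after contracting the block and `R_i[r]` is the sum of
all elements of `C_{l+1}`. -/
def dendCirc (𝒱 : ℤ → Submodule K V) [DirectSum.Decomposition 𝒱] (D : DendOps K V)
    (N : ℕ) (r : Fin (N + 1)) (x : Fin (N + 1) → V) : V :=
  ∑ kl ∈ Finset.HasAntidiagonal.antidiagonal N, ∑ i : Fin (kl.1 + 1),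
    if r.val < i.val then
      D kl.1 (Fin.ofNat (kl.1 + 1) r.val)
        (insertAt (sgn 𝒱 1) kl.1 kl.2 N i.val (fun z => ∑ s, D kl.2 s z) x)
    else if r.val ≤ i.val + kl.2 then
      D kl.1 i
        (insertAt (sgn 𝒱 1) kl.1 kl.2 N i.val (D kl.2 (Fin.ofNat (kl.2 + 1) (r.val - i.val))) x)
    else
      D kl.1 (Fin.ofNat (kl.1 + 1) (r.val - kl.2))
        (insertAt (sgn 𝒱 1) kl.1 kl.2 N i.val (fun z => ∑ s, D kl.2 s z) x)

/-- `Dend_∞[1]`-algebras: degree `1` elements `D` with `[D, D] = 2 D ∘ D = 0`. -/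
structure IsDendInfAlgebra (𝒱 : ℤ → Submodule K V) [DirectSum.Decomposition 𝒱]
    (D : DendOps K V) : Prop where
  degree : ∀ k r, HasDegree 𝒱 𝒱 1 (D k r)
  identity : ∀ N r x, dendCirc 𝒱 D N r x = 0

open Classical in
/-- The circle product `θ ∘ θ` underlying the Matsushima-Nijenhuis bracket on
`Hom(S(V) ⊗ V, V)`, for `θ` of degree `1`. The last argument is the distinguished one.
With `i = l + 1`, `j = k + 1` and `n = N + 1` it is the sum over `i + j = n + 1` of
`∑_{σ ∈ S_{(i-1,1,j-2)}} ε(σ) θ_j(θ_i(x_{σ(1)}, …, x_{σ(i)}), x_{σ(i+1)}, …, x_{σ(n-1)}, x_n)`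
(for `j ≥ 2`) and
`∑_{σ ∈ S_{(j-1,i-1)}} ± ε(σ) θ_j(x_{σ(1)}, …, x_{σ(j-1)}, θ_i(x_{σ(j)}, …, x_{σ(n-1)}, x_n))`
with the sign `(-1)^{|x_{σ(1)}| + ⋯ + |x_{σ(j-1)}|}`. -/
def preLieCirc (𝒱 : ℤ → Submodule K V) [DirectSum.Decomposition 𝒱] (θ : Ops K V V)
    (N : ℕ) (x : Fin (N + 1) → V) : V :=
  ∑ kl ∈ Finset.HasAntidiagonal.antidiagonal N,
    ((if 1 ≤ kl.1 then
        koszulSum 𝒱 (fun σ y =>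
          if σ (Fin.last N) = Fin.last N ∧
              ∀ i j : Fin (N + 1), i < j → j.val < N → (j.val < kl.2 ∨ kl.2 < i.val) → σ i < σ j
          then θ kl.1 (insertAt id kl.1 kl.2 N 0 (θ kl.2) y) else 0) x
      else 0) +
      koszulSum 𝒱 (fun σ y =>
        if σ (Fin.last N) = Fin.last N ∧
            ∀ i j : Fin (N + 1), i < j → j.val < N → (j.val < kl.1 ∨ kl.1 ≤ i.val) → σ i < σ j
        then θ kl.1 (insertAt (sgn 𝒱 1) kl.1 kl.2 N kl.1 (θ kl.2) y) else 0) x)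

/-- `pre-Lie_∞[1]`-algebras: degree `1` elements `θ` of `Hom(S(V) ⊗ V, V)` (graded symmetric in
all arguments but the last) with `[θ, θ] = 2 θ ∘ θ = 0`. -/
structure IsPreLieInfAlgebra (𝒱 : ℤ → Submodule K V) [DirectSum.Decomposition 𝒱]
    (θ : Ops K V V) : Prop where
  degree : ∀ k, HasDegree 𝒱 𝒱 1 (θ k)
  symm : ∀ k (σ : Equiv.Perm (Fin (k + 1))), σ (Fin.last k) = Fin.last k →
    ∀ (d : Fin (k + 1) → ℤ) (x : Fin (k + 1) → V), (∀ i, x i ∈ 𝒱 (d i)) →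
      θ k (fun i => x (σ i)) = koszulSign σ (fun i => (d i : ZMod 2)) • θ k x
  identity : ∀ N x, preLieCirc 𝒱 θ N x = 0

/-- The operations
`θ_k(x_1, …, x_k) = ∑_σ ε(σ) μ_{k,[σ⁻¹(k)]}(x_{σ(1)}, …, x_{σ(k)})`
of the `pre-Lie_∞[1]`-algebra obtained from a `Dend_∞[1]`-algebra. -/
def preLieOfDend (𝒱 : ℤ → Submodule K V) [DirectSum.Decomposition 𝒱] (D : DendOps K V) :
    Ops K V V :=
  fun k => koszulSumMap 𝒱 (fun σ => D k (σ⁻¹ (Fin.last k)))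

end Structures

section RelativeRotaBaxter

variable {K : Type*} [Field K] {A M : Type*} [AddCommGroup A] [Module K A]
  [AddCommGroup M] [Module K M]

variable (𝒜 : ℤ → Submodule K A) [DirectSum.Decomposition 𝒜]
  (ℳ : ℤ → Submodule K M) [DirectSum.Decomposition ℳ]

/-- Bimodules over an `A_∞[1]`-algebra: the `A_∞[1]`-identities hold whenever exactly one argument
is from `M`, with `η` in place of `μ` where an argument is from `M`. -/
structure IsAInfBimodule (μ : Ops K A A) (η : Ops K (A × M) M) : Prop where
  degree : ∀ k, HasDegree (prodGrading 𝒜 ℳ) ℳ 1 (η k)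
  linearInM : IsLinearInM η
  identity : ∀ N (x : Fin (N + 1) → A × M), OneFromM x →
    circ (prodGrading 𝒜 ℳ) 1 (liftOps μ η) (liftOps μ η) N x = 0

/-- Modules over an `L_∞[1]`-algebra. The maps `ρ_k` on `S^{k-1}(A) ⊗ M` are extended to all
positions of the argument from `M` by graded symmetry. -/
structure IsLInfModule (l : Ops K A A) (ρ : Ops K (A × M) M) : Prop where
  degree : ∀ k, HasDegree (prodGrading 𝒜 ℳ) ℳ 1 (ρ k)
  symm : ∀ k, IsGradedSymm (prodGrading 𝒜 ℳ) (ρ k)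
  linearInM : IsLinearInM ρ
  identity : ∀ N (x : Fin (N + 1) → A × M), OneFromM x →
    symmCirc (prodGrading 𝒜 ℳ) (liftOps l ρ) (liftOps l ρ) N x = 0

/-- The higher derived bracket `P[⋯[[Δ, T], T], ⋯, T]` (`n` copies of `T`), where
`Δ = μ + η` and `P` is the projection of `Hom(T̄(A ⊕ M), A ⊕ M)` to `Hom(T̄ M, A)`. -/
def derivedBracket (μ : Ops K A A) (η : Ops K (A × M) M) (T : Ops K M A) (n N : ℕ)
    (u : Fin (N + 1) → M) : A :=
  ((fun F => bracket (prodGrading 𝒜 ℳ) 1 0 F (liftMap T))^[n] (liftOps μ η) N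
    (fun i => (0, u i))).1

/-- Homotopy relative Rota-Baxter operators on a bimodule over an `A_∞[1]`-algebra: degree `0`
elements satisfying the Maurer-Cartan equation `∑_{n ≥ 1} (1/n!) l_n(T, …, T) = 0`. In each arity
only finitely many terms are nonzero. -/
structure IsHomotopyRRB (μ : Ops K A A) (η : Ops K (A × M) M) (T : Ops K M A) : Prop where
  degree : ∀ k, HasDegree ℳ 𝒜 0 (T k)
  maurerCartan : ∀ N (u : Fin (N + 1) → M),
    ∑ᶠ n : ℕ, ((Nat.factorial (n + 1) : K)⁻¹) • derivedBracket 𝒜 ℳ μ η T (n + 1) N u = 0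

/-- The higher derived bracket `P[⋯[[Δ, T], T], ⋯, T]` (`n` copies of `T`), where
`Δ = l + ρ` and `P` is the projection of `Hom(S̄(A ⊕ M), A ⊕ M)` to `Hom(S̄ M, A)`. -/
def symmDerivedBracket (l : Ops K A A) (ρ : Ops K (A × M) M) (T : Ops K M A) (n N : ℕ)
    (u : Fin (N + 1) → M) : A :=
  ((fun F => symmBracket (prodGrading 𝒜 ℳ) 1 0 F (liftMap T))^[n] (liftOps l ρ) N
    (fun i => (0, u i))).1

/-- Homotopy relative Rota-Baxter operators on a module over an `L_∞[1]`-algebra. -/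
structure IsHomotopyRRBLie (l : Ops K A A) (ρ : Ops K (A × M) M) (T : Ops K M A) : Prop where
  degree : ∀ k, HasDegree ℳ 𝒜 0 (T k)
  symm : ∀ k, IsGradedSymm ℳ (T k)
  maurerCartan : ∀ N (u : Fin (N + 1) → M),
    ∑ᶠ n : ℕ, ((Nat.factorial (n + 1) : K)⁻¹) • symmDerivedBracket 𝒜 ℳ l ρ T (n + 1) N u = 0

/-- Strict homotopy relative Rota-Baxter operators over an `A_∞[1]`-algebra. -/
def IsStrictHomotopyRRB (μ : Ops K A A) (η : Ops K (A × M) M) (T : M →ₗ[K] A) : Prop :=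
  IsHomotopyRRB 𝒜 ℳ μ η (strictFamily T)

/-- Strict homotopy relative Rota-Baxter operators over an `L_∞[1]`-algebra. -/
def IsStrictHomotopyRRBLie (l : Ops K A A) (ρ : Ops K (A × M) M) (T : M →ₗ[K] A) : Prop :=
  IsHomotopyRRBLie 𝒜 ℳ l ρ (strictFamily T)

/-- The operations `μ_{k,[r]}(u_1, …, u_k) = η_k(T u_1, …, u_r, …, T u_k)` of the subadjacent
`Dend_∞[1]`-algebra. -/
def dendOfRRB (η : Ops K (A × M) M) (T : M →ₗ[K] A) : DendOps K M :=
  fun k r => (η k).compLinearMap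
    (fun i => if i = r then LinearMap.inr K A M else LinearMap.inl K A M ∘ₗ T)

/-- The operations `θ_k(v_1, …, v_k) = ρ_k(T v_1, …, T v_{k-1}, v_k)` of the
`pre-Lie_∞[1]`-algebra induced by a strict operator over an `L_∞[1]`-algebra. -/
def preLieOfRRBLie (ρ : Ops K (A × M) M) (T : M →ₗ[K] A) : Ops K M M :=
  fun k => (ρ k).compLinearMap
    (fun i => if i = Fin.last k then LinearMap.inr K A M else LinearMap.inl K A M ∘ₗ T)

end RelativeRotaBaxter

end HomotopyRB

end

open HomotopyRB

/-! Write `E (a, m) = (T m, 0)`, so that `E² = 0`. For strict `T`, bracketing with `T` is the sum of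
the operators "apply `E` to one entry" minus "apply `E` to the output". These commute and square to
zero, so the iterates are elementary symmetric expressions (`iterate_strictBracket_apply`). On
arguments from `M`, `μ` survives only if `E` hits every entry, and `η` only if it misses exactly
one. In arity `k` the Maurer-Cartan equation thus reduces to the term with `k` copies of `T`, which
is `RotaBaxterIdentity`: `μ_k(Tu_1, …, Tu_k) = T ∑_r η_k(Tu_1, …, u_r, …, Tu_k)`.

The `Dend_∞[1]`-identity with index `[r]` is the bimodule identity at `(Tu_1, …, u_r, …, Tu_n)`. If
the inner operation contains `u_r`, it is some `μ_{l,[s]}`; otherwise the Rota-Baxter identity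
rewrites it as `T` of the sum of all of them (`dendCirc_dendOfRRB`).

Symmetrization turns the circle product on `Hom(T̄V, V)` into the one on `Hom(S̄V, V)`
(`symmCirc_symmetrize`): both sides become sums over all permutations once multiplied by factorials,
which can be cancelled in characteristic zero. Applied to `V = A` and `V = A ⊕ M`, this yields the
algebra, the module and the symmetric derived brackets.

The pre-Lie identity is the module identity at `(Tu_1, …, Tu_{n-1}, u_n)`, split by whether `u_n`
lies inside the inner operation (`sum_moduleTerm_inner`) or outside it (`sum_moduleTerm_outer`). The
two families `θ`, `θ'` agree by bookkeeping: permuting `(Tu_1, …, Tu_{k-1}, u_k)` by `σ` carries the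
entry from `M` to position `σ⁻¹(k)`. Hence the pre-Lie identity needs to be proved only for `θ'`. -/

open scoped DirectSum

noncomputable section

namespace HomotopyRB

/-! ### Koszul signs: cocycle rule and special permutations. -/

section Signs

/-- The sign `(-1)^a`. -/
def paritySign (a : ZMod 2) : ℤ := if a = 1 then -1 else 1

theorem paritySign_zero : paritySign 0 = 1 := by decide

theorem paritySign_add (a b : ZMod 2) : paritySign (a + b) = paritySign a * paritySign b := by
  revert a b; decide

theorem paritySign_sum {ι : Type*} (s : Finset ι) (a : ι → ZMod 2) :
    paritySign (∑ i ∈ s, a i) = ∏ i ∈ s, paritySign (a i) := by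
  classical
  induction s using Finset.induction_on with
  | empty => simp [paritySign_zero]
  | insert i s hi ih => rw [Finset.sum_insert hi, Finset.prod_insert hi, paritySign_add, ih]

/-- A permutation permutes the unordered pairs, and symmetry of `g` makes each factor depend only on
its pair. -/
theorem prod_pairs_comp_perm {n : ℕ} (τ : Equiv.Perm (Fin n)) (g : Fin n → Fin n → ℤ)
    (hg : ∀ i j, g i j = g j i) :
    ∏ i, ∏ j, (if i < j then g (τ i) (τ j) else 1) = ∏ i, ∏ j, (if i < j then g i j else 1) := by
  rw [← Finset.prod_product', ← Finset.prod_product', ← Finset.prod_filter, ← Finset.prod_filter]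
  refine Finset.prod_bij'
    (fun a _ => if τ a.1 < τ a.2 then (τ a.1, τ a.2) else (τ a.2, τ a.1))
    (fun a _ => if τ.symm a.1 < τ.symm a.2 then (τ.symm a.1, τ.symm a.2)
      else (τ.symm a.2, τ.symm a.1)) ?_ ?_ ?_ ?_ ?_
  · rintro ⟨i, j⟩ h
    simp only [Finset.mem_filter, Finset.mem_product, Finset.mem_univ, true_and] at h ⊢
    have : τ i ≠ τ j := fun h' => h.ne (τ.injective h')
    split_ifs with h1
    · exact h1
    · exact lt_of_le_of_ne (not_lt.mp h1) this.symm
  · rintro ⟨i, j⟩ h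
    simp only [Finset.mem_filter, Finset.mem_product, Finset.mem_univ, true_and] at h ⊢
    have : τ.symm i ≠ τ.symm j := fun h' => h.ne (τ.symm.injective h')
    split_ifs with h1
    · exact h1
    · exact lt_of_le_of_ne (not_lt.mp h1) this.symm
  · rintro ⟨i, j⟩ h
    simp only [Finset.mem_filter, Finset.mem_product, Finset.mem_univ, true_and] at h ⊢
    by_cases h1 : τ i < τ j
    · simp [h1, h]
    · simp [h1, h.not_gt]
  · rintro ⟨i, j⟩ h
    simp only [Finset.mem_filter, Finset.mem_product, Finset.mem_univ, true_and] at h ⊢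
    by_cases h1 : τ.symm i < τ.symm j
    · simp [h1, h]
    · simp [h1, h.not_gt]
  · rintro ⟨i, j⟩ h
    by_cases h1 : τ i < τ j
    · simp [h1]
    · simp [h1, hg (τ i)]

/-- A pair is inverted by `σ * τ` exactly when one, but not both, of the following holds: `τ`
inverts it, or `σ` inverts its image under `τ`. Pairs counted twice contribute `(-1)² = 1`. -/
theorem koszulSign_mul {n : ℕ} (σ τ : Equiv.Perm (Fin n)) (p : Fin n → ZMod 2) :
    koszulSign (σ * τ) p = koszulSign σ p * koszulSign τ (fun i => p (σ i)) := by
  -- The inversion sign is made symmetric in its two indices, so that its product over pairs can be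
  -- reindexed along `τ`.
  let χ : Equiv.Perm (Fin n) → Fin n → Fin n → ℤ := fun σ i j =>
    if ((i < j ∧ σ j < σ i) ∨ (j < i ∧ σ i < σ j)) ∧ p (σ i) = 1 ∧ p (σ j) = 1 then -1 else 1
  have h1 : koszulSign σ p = ∏ i, ∏ j, (if i < j then χ σ (τ i) (τ j) else 1) := by
    rw [prod_pairs_comp_perm τ (χ σ) (by intro i j; simp only [χ]; congr 1; grind)]
    refine Finset.prod_congr rfl fun i _ => Finset.prod_congr rfl fun j _ => ?_
    simp only [χ]
    grind
  rw [h1]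
  simp only [koszulSign, ← Finset.prod_mul_distrib]
  refine Finset.prod_congr rfl fun i _ => Finset.prod_congr rfl fun j _ => ?_
  have h2 : τ i = τ j → i = j := fun h => τ.injective h
  have h3 : σ (τ i) = σ (τ j) → τ i = τ j := fun h => σ.injective h
  simp only [χ, Equiv.Perm.coe_mul, Function.comp_apply]
  by_cases hp : p (σ (τ i)) = 1 ∧ p (σ (τ j)) = 1
  · by_cases hij : i < j
    · rcases lt_trichotomy (τ i) (τ j) with h | h | h
      · simp [hp, hij, h, h.not_gt]
      · exact absurd (h2 h) hij.ne
      · rcases lt_trichotomy (σ (τ i)) (σ (τ j)) with h' | h' | h'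
        · simp [hp, hij, h, h.not_gt, h', h'.not_gt]
        · exact absurd (h3 h') h.ne'
        · simp [hp, hij, h, h.not_gt, h', h'.not_gt]
    · simp [hij]
  · simp [hp]

theorem koszulSign_one {n : ℕ} (p : Fin n → ZMod 2) : koszulSign 1 p = 1 := by
  refine Finset.prod_eq_one fun i _ => Finset.prod_eq_one fun j _ => if_neg ?_
  rintro ⟨h, h', -⟩
  exact h.not_gt h'

theorem koszulSign_mul_self {n : ℕ} (σ : Equiv.Perm (Fin n)) (p : Fin n → ZMod 2) :
    koszulSign σ p * koszulSign σ p = 1 := by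
  simp only [koszulSign, ← Finset.prod_mul_distrib]
  refine Finset.prod_eq_one fun i _ => Finset.prod_eq_one fun j _ => ?_
  split_ifs <;> simp

theorem koszulSign_smul_smul {n : ℕ} {W : Type*} [AddCommGroup W] (σ : Equiv.Perm (Fin n))
    (p : Fin n → ZMod 2) (w : W) : koszulSign σ p • koszulSign σ p • w = w := by
  rw [smul_smul, koszulSign_mul_self, one_smul]

/-- A permutation supported on an interval has the Koszul sign of its restriction. -/
theorem koszulSign_extend {m n : ℕ} (f : Fin m → Fin n) (hf : StrictMono f)
    (hint : ∀ j, j ∉ Set.range f → (∀ r, f r < j) ∨ ∀ r, j < f r)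
    (τ : Equiv.Perm (Fin m)) (τ' : Equiv.Perm (Fin n)) (h1 : ∀ r, τ' (f r) = f (τ r))
    (h2 : ∀ j, j ∉ Set.range f → τ' j = j) (p : Fin n → ZMod 2) :
    koszulSign τ' p = koszulSign τ (fun r => p (f r)) := by
  symm
  refine Fintype.prod_of_injective f hf.injective _ _ ?_ ?_
  · intro i hi
    refine Finset.prod_eq_one fun j _ => if_neg ?_
    rintro ⟨h, h', -⟩
    rw [h2 i hi] at h'
    by_cases hj : j ∈ Set.range f
    · obtain ⟨r, rfl⟩ := hj
      rw [h1] at h'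
      rcases hint i hi with h3 | h3
      · exact absurd h (h3 r).not_gt
      · exact absurd h' (h3 _).not_gt
    · rw [h2 j hj] at h'
      exact h.not_gt h'
  · intro i
    refine Fintype.prod_of_injective f hf.injective _ _ ?_ ?_
    · intro j hj
      refine if_neg ?_
      rintro ⟨h, h', -⟩
      rw [h2 j hj, h1] at h'
      rcases hint j hj with h3 | h3
      · exact absurd h' (h3 _).not_gt
      · exact absurd h (h3 i).not_gt
    · intro j
      simp only [h1, hf.lt_iff_lt]

/-- The Koszul sign of a permutation whose inversions are the pairs in `[0, i) × [i, j)`. -/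
theorem koszulSign_of_inversions {n : ℕ} (σ : Equiv.Perm (Fin n)) (i j : ℕ)
    (h : ∀ a b : Fin n, (a < b ∧ σ b < σ a) ↔ (a.val < i ∧ i ≤ b.val ∧ b.val < j))
    (p : Fin n → ZMod 2) :
    koszulSign σ p = paritySign ((∑ a : Fin n, if a.val < i then p (σ a) else 0) *
      ∑ b : Fin n, if i ≤ b.val ∧ b.val < j then p (σ b) else 0) := by
  rw [Finset.sum_mul_sum, paritySign_sum]
  refine Finset.prod_congr rfl fun a _ => ?_
  rw [paritySign_sum]
  refine Finset.prod_congr rfl fun b _ => ?_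
  have := h a b
  by_cases h1 : a.val < i
  · by_cases h2 : i ≤ b.val ∧ b.val < j
    · have h3 := this.mpr ⟨h1, h2⟩
      simp only [h1, h2, h3, true_and, if_true, and_self]
      generalize p (σ a) = u
      generalize p (σ b) = v
      revert u v
      decide
    · rw [if_neg h2, mul_zero, paritySign_zero]
      exact if_neg fun h4 => h2 (this.mp ⟨h4.1, h4.2.1⟩).2
  · rw [if_neg h1, zero_mul, paritySign_zero]
    exact if_neg fun h4 => h1 (this.mp ⟨h4.1, h4.2.1⟩).1

end Signs

/-! ### Young subgroups and shuffle representatives. -/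

section Young

/-- Permutations increasing on the blocks of `b`. -/
def IncreasingOnBlocks {n : ℕ} {ι : Type*} (b : Fin n → ι) (σ : Equiv.Perm (Fin n)) : Prop :=
  ∀ i j, i < j → b i = b j → σ i < σ j

/-- Uniqueness of shuffle representatives of a coset: `τ` preserves the order between blocks because
`b` is monotone, and within blocks because `ρ` and `ρ * τ` are both increasing there. A strictly
monotone permutation of `Fin n` is trivial. -/
theorem eq_one_of_increasingOnBlocks {n : ℕ} {ι : Type*} [LinearOrder ι] {b : Fin n → ι}
    (hb : Monotone b) {ρ τ : Equiv.Perm (Fin n)} (hτ : b ∘ τ = b) (h1 : IncreasingOnBlocks b ρ)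
    (h2 : IncreasingOnBlocks b (ρ * τ)) : τ = 1 := by
  have hb' : ∀ i, b (τ i) = b i := fun i => congrFun hτ i
  have hm : StrictMono τ := by
    intro i j hij
    rcases (hb hij.le).lt_or_eq with h | h
    · rw [← hb' i, ← hb' j] at h
      exact lt_of_not_ge fun h' => (hb h').not_gt h
    · refine lt_of_not_ge fun h' => ?_
      have h'' : τ j < τ i := lt_of_le_of_ne h' fun h3 => hij.ne' (τ.injective h3)
      exact (h1 _ _ h'' (by rw [hb', hb', h])).not_gt (h2 i j hij h)
  have : (τ : Fin n → Fin n) = id := by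
    have h := Subsingleton.elim (α := Fin n ≃o Fin n) (hm.orderIsoOfSurjective _ τ.surjective)
      (OrderIso.refl _)
    funext i
    exact congrArg (fun e : Fin n ≃o Fin n => e i) h
  ext i
  simp [this]

/-- Sort the positions lexicographically, first by block and then by their value under `σ`. The
blocks are already in order, so sorting only rearranges within them. -/
theorem exists_increasingOnBlocks {n : ℕ} {ι : Type*} [LinearOrder ι] {b : Fin n → ι}
    (hb : Monotone b) (σ : Equiv.Perm (Fin n)) :
    ∃ τ : Equiv.Perm (Fin n), b ∘ τ = b ∧ IncreasingOnBlocks b (σ * τ) := by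
  let f : Fin n → ι ×ₗ Fin n := fun i => toLex (b i, σ i)
  have hf := Tuple.monotone_sort f
  have hbτ : b ∘ Tuple.sort f = b ∘ (1 : Equiv.Perm (Fin n)) := by
    refine Tuple.unique_monotone (f := b) ?_ hb
    intro i j hij
    have := hf hij
    simp only [f, Function.comp_apply, Prod.Lex.toLex_le_toLex] at this
    rcases this with h | h
    · exact h.le
    · exact h.1.le
  refine ⟨Tuple.sort f, hbτ, ?_⟩
  intro i j hij hbij
  have hb' : ∀ i, b (Tuple.sort f i) = b i := fun i => congrFun hbτ i
  have := hf hij.le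
  simp only [f, Function.comp_apply, Prod.Lex.toLex_le_toLex] at this
  rcases this with h | h
  · rw [hb', hb', hbij] at h
    exact absurd h (lt_irrefl _)
  · refine lt_of_le_of_ne h.2 fun h3 => hij.ne ?_
    exact (Tuple.sort f).injective (σ.injective h3)

/-- Each `x` is carried to `τ x` by one transposition inside its block. Invariance under a Young
subgroup may therefore be tested on transpositions. -/
theorem mem_closure_swap_of_comp_eq {n : ℕ} {ι : Type*} {b : Fin n → ι} {τ : Equiv.Perm (Fin n)}
    (hτ : b ∘ τ = b) :
    τ ∈ Subgroup.closure {f : Equiv.Perm (Fin n) | ∃ i j, i ≠ j ∧ b i = b j ∧ f = Equiv.swap i j} := by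
  refine (_root_.mem_closure_isSwap ?_).mpr ⟨Set.toFinite _, fun x => ?_⟩
  · rintro f ⟨i, j, hij, -, rfl⟩
    exact ⟨i, j, hij, rfl⟩
  · by_cases hx : τ x = x
    · rw [hx]; exact MulAction.mem_orbit_self x
    · refine ⟨⟨Equiv.swap x (τ x), Subgroup.subset_closure
        ⟨x, τ x, fun h => hx h.symm, (congrFun hτ x).symm, rfl⟩⟩, ?_⟩
      simp [Subgroup.smul_def]

open Classical in
/-- Sums of functions invariant under a Young subgroup reduce to sums over shuffles. -/
theorem sum_perm_eq_smul_sum_shuffles {n : ℕ} {ι : Type*} [LinearOrder ι] [Fintype ι] {W : Type*}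
    [AddCommMonoid W] {b : Fin n → ι} (hb : Monotone b) (H : Equiv.Perm (Fin n) → W)
    (hH : ∀ σ i j, i ≠ j → b i = b j → H (σ * Equiv.swap i j) = H σ) :
    ∑ σ, H σ = (∏ c, (Fintype.card {a // b a = c}).factorial) •
      ∑ σ, if IncreasingOnBlocks b σ then H σ else 0 := by
  have hinv : ∀ τ : Equiv.Perm (Fin n), b ∘ τ = b → ∀ σ, H (σ * τ) = H σ := by
    intro τ hτ
    refine Subgroup.closure_induction (p := fun τ _ => ∀ σ, H (σ * τ) = H σ) ?_ ?_ ?_ ?_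
      (mem_closure_swap_of_comp_eq hτ)
    · rintro f ⟨i, j, hij, hb, rfl⟩ σ
      exact hH σ i j hij hb
    · intro σ; rw [mul_one]
    · intro x y _ _ hx hy σ
      rw [← mul_assoc, hy, hx]
    · intro x _ hx σ
      rw [← hx (σ * x⁻¹), inv_mul_cancel_right]
  rw [← DomMulAct.stabilizer_card b, ← Finset.sum_filter, ← Finset.card_univ, Finset.smul_sum]
  have h1 : ∀ ρ : Equiv.Perm (Fin n), (Finset.univ (α := {g : Equiv.Perm (Fin n) // b ∘ g = b})).card • H ρ =
      ∑ τ : {g : Equiv.Perm (Fin n) // b ∘ g = b}, H (ρ * τ) := by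
    intro ρ
    rw [Finset.sum_congr rfl fun τ _ => hinv τ.1 τ.2 ρ, Finset.sum_const]
  rw [Finset.sum_congr rfl fun ρ _ => h1 ρ, ← Finset.sum_product']
  symm
  -- Every permutation factors uniquely as a shuffle times an element of the Young subgroup, whose
  -- order is the product of factorials.
  refine Finset.sum_bij (fun a _ => a.1 * a.2) (fun _ _ => Finset.mem_univ _) ?_ ?_ fun _ _ => rfl
  · rintro ⟨ρ, τ, hτ⟩ h ⟨ρ', τ', hτ'⟩ h' (he : ρ * τ = ρ' * τ')
    simp only [Finset.mem_product, Finset.mem_filter, Finset.mem_univ, true_and, and_true] at h h'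
    have e1 : ρ' = ρ * (τ * τ'⁻¹) := by rw [← mul_assoc, he, mul_inv_cancel_right]
    have e2 : b ∘ (τ * τ'⁻¹ : Equiv.Perm (Fin n)) = b := by
      funext i
      have e3 := congrFun hτ' (τ'⁻¹ i)
      have e4 := congrFun hτ (τ'⁻¹ i)
      simp only [Function.comp_apply, Equiv.Perm.coe_inv, Equiv.apply_symm_apply, Equiv.Perm.coe_mul] at e3 e4 ⊢
      rw [e4, e3]
    have e5 := eq_one_of_increasingOnBlocks hb e2 h (e1 ▸ h')
    have e6 : τ = τ' := mul_inv_eq_one.mp e5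
    subst e6
    have e7 : ρ = ρ' := mul_right_cancel he
    subst e7
    rfl
  · intro σ _
    obtain ⟨τ, hτ, h⟩ := exists_increasingOnBlocks hb σ
    refine ⟨(σ * τ, ⟨τ⁻¹, ?_⟩), ?_, ?_⟩
    · funext i
      have := congrFun hτ (τ⁻¹ i)
      simp only [Function.comp_apply, Equiv.Perm.coe_inv, Equiv.apply_symm_apply] at this ⊢
      exact this.symm
    · simpa using h
    · simp

end Young

/-! ### Parity decomposition, and graded symmetry tested on entries of pure parity. -/

section Parity

variable {K : Type*} [Field K] {V W : Type*} [AddCommGroup V] [Module K V]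
  [AddCommGroup W] [Module K W]
  (𝒱 : ℤ → Submodule K V) [DirectSum.Decomposition 𝒱]
  (𝒲 : ℤ → Submodule K W) [DirectSum.Decomposition 𝒲]

theorem negOnePow_eq_paritySign (m : ℤ) : (m.negOnePow : ℤ) = paritySign (m : ZMod 2) := by
  have h2 : (2 : ZMod 2) = 0 := by decide
  rcases Int.even_or_odd' m with ⟨k, rfl | rfl⟩
  · rw [Int.negOnePow_even _ (even_two_mul k)]
    simp [h2, paritySign]
  · rw [Int.negOnePow_odd _ (odd_two_mul_add_one k)]
    simp [h2, paritySign]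

theorem sum_parityPart (v : V) : ∑ p, parityPart 𝒱 p v = v := by
  induction v using DirectSum.Decomposition.inductionOn 𝒱 with
  | zero => simp
  | @homogeneous i v =>
    rw [Finset.sum_congr rfl fun p _ => parityPart_of_mem 𝒱 p v.2]
    simp
  | add v w hv hw => simp only [map_add, Finset.sum_add_distrib, hv, hw]

theorem parityPart_parityPart (p q : ZMod 2) (v : V) :
    parityPart 𝒱 p (parityPart 𝒱 q v) = if p = q then parityPart 𝒱 q v else 0 := by
  induction v using DirectSum.Decomposition.inductionOn 𝒱 with
  | zero => simp
  | @homogeneous i v =>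
    rw [parityPart_of_mem 𝒱 q v.2]
    by_cases h : (i : ZMod 2) = q
    · rw [if_pos h, parityPart_of_mem 𝒱 p v.2, h]
      simp only [eq_comm]
    · rw [if_neg h]; simp
  | add v w hv hw => rw [map_add, map_add, hv, hw]; split_ifs <;> simp

theorem parityPart_of_ne {p q : ZMod 2} (hpq : p ≠ q) {v : V} (hv : parityPart 𝒱 q v = v) :
    parityPart 𝒱 p v = 0 := by
  rw [← hv, parityPart_parityPart, if_neg hpq]

theorem sgn_parityPart (n : ℤ) (p : ZMod 2) (v : V) :
    sgn 𝒱 n (parityPart 𝒱 p v) = paritySign (n * p) • parityPart 𝒱 p v := by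
  induction v using DirectSum.Decomposition.inductionOn 𝒱 with
  | zero => simp
  | @homogeneous i v =>
    rw [parityPart_of_mem 𝒱 p v.2]
    by_cases h : (i : ZMod 2) = p
    · rw [if_pos h, sgn_of_mem 𝒱 n v.2, negOnePow_eq_paritySign, ← h]
      push_cast
      rfl
    · rw [if_neg h]; simp
  | add v w hv hw => rw [map_add, map_add, hv, hw, smul_add]

theorem sgn_of_parity (n : ℤ) {p : ZMod 2} {v : V} (hv : parityPart 𝒱 p v = v) :
    sgn 𝒱 n v = paritySign (n * p) • v := by
  rw [← hv, sgn_parityPart]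

theorem sgn_zero (v : V) : sgn 𝒱 0 v = v := by
  induction v using DirectSum.Decomposition.inductionOn 𝒱 with
  | zero => simp
  | @homogeneous i v => rw [sgn_of_mem 𝒱 0 v.2]; simp
  | add v w hv hw => rw [map_add, hv, hw]

theorem parityPart_self_of_mem {i : ℤ} {v : V} (hv : v ∈ 𝒱 i) :
    parityPart 𝒱 (i : ZMod 2) v = v := by
  rw [parityPart_of_mem 𝒱 _ hv, if_pos rfl]

variable {𝒱 𝒲} in
theorem parityPart_map (T : V →ₗ[K] W) (hT : ∀ i v, v ∈ 𝒱 i → T v ∈ 𝒲 i) (p : ZMod 2) (v : V) :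
    parityPart 𝒲 p (T v) = T (parityPart 𝒱 p v) := by
  induction v using DirectSum.Decomposition.inductionOn 𝒱 with
  | zero => simp
  | @homogeneous i v =>
    rw [parityPart_of_mem 𝒱 p v.2, parityPart_of_mem 𝒲 p (hT i v v.2)]
    split_ifs <;> simp
  | add v w hv hw => simp only [map_add, hv, hw]

variable {𝒱 𝒲} in
theorem sgn_map (T : V →ₗ[K] W) (hT : ∀ i v, v ∈ 𝒱 i → T v ∈ 𝒲 i) (n : ℤ) (v : V) :
    sgn 𝒲 n (T v) = T (sgn 𝒱 n v) := by
  induction v using DirectSum.Decomposition.inductionOn 𝒱 with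
  | zero => simp
  | @homogeneous i v =>
    rw [sgn_of_mem 𝒱 n v.2, sgn_of_mem 𝒲 n (hT i v v.2), map_zsmul]
  | add v w hv hw => simp only [map_add, hv, hw]

/-- Multilinear maps agreeing on homogeneous tuples are equal. -/
theorem multilinearMap_ext_homogeneous {k : ℕ} {f g : MultilinearMap K (fun _ : Fin k => V) W}
    (h : ∀ (d : Fin k → ℤ) (x : Fin k → V), (∀ i, x i ∈ 𝒱 (d i)) → f x = g x) : f = g := by
  have key : f.compLinearMap (fun _ => (DirectSum.decomposeLinearEquiv 𝒱).symm.toLinearMap) =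
      g.compLinearMap (fun _ => (DirectSum.decomposeLinearEquiv 𝒱).symm.toLinearMap) := by
    refine MultilinearMap.dfinsupp_ext fun d => ?_
    ext x
    refine h d _ fun i => ?_
    have : (DirectSum.decomposeLinearEquiv 𝒱).symm (DirectSum.lof K ℤ (fun i => 𝒱 i) (d i) (x i)) = (x i : V) :=
      DirectSum.decompose_symm_of 𝒱 (x i)
    exact this.symm ▸ (x i).2
  ext x
  have := DFunLike.congr_fun key (fun i => DirectSum.decomposeLinearEquiv 𝒱 (x i))
  simpa using this

/-- A multilinear map changing parities by `n`. -/
def HasParity (n : ZMod 2) {k : ℕ} (f : MultilinearMap K (fun _ : Fin k => V) W) : Prop :=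
  ∀ (q : Fin k → ZMod 2) (y : Fin k → V), (∀ i, parityPart 𝒱 (q i) (y i) = y i) →
    parityPart 𝒲 ((∑ i, q i) + n) (f y) = f y

-- An element of pure parity need not be homogeneous, so the claim is phrased as an equality of
-- multilinear maps and checked on homogeneous tuples. All later sign computations use parities
-- only.
variable {𝒱 𝒲} in
theorem HasDegree.hasParity {n : ℤ} {k : ℕ} {f : MultilinearMap K (fun _ : Fin k => V) W}
    (hf : HasDegree 𝒱 𝒲 n f) : HasParity 𝒱 𝒲 (n : ZMod 2) f := by
  intro q y hy
  have key : (parityPart 𝒲 ((∑ i, q i) + n)).compMultilinearMap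
      (f.compLinearMap fun i => parityPart 𝒱 (q i)) = f.compLinearMap fun i => parityPart 𝒱 (q i) := by
    refine multilinearMap_ext_homogeneous 𝒱 fun d x hx => ?_
    simp only [LinearMap.compMultilinearMap_apply, MultilinearMap.compLinearMap_apply]
    by_cases h : ∀ i, (d i : ZMod 2) = q i
    · have e : (fun i => parityPart 𝒱 (q i) (x i)) = x := by
        funext i
        rw [parityPart_of_mem 𝒱 _ (hx i), if_pos (h i)]
      rw [e, parityPart_of_mem 𝒲 _ (hf d x hx), if_pos]
      push_cast
      simp only [h]
    · push Not at h
      obtain ⟨i, hi⟩ := h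
      rw [f.map_coord_zero i, map_zero]
      rw [parityPart_of_mem 𝒱 _ (hx i), if_neg hi]
  have := DFunLike.congr_fun key y
  simpa [hy] using this

/-- Graded symmetry, tested on tuples of elements of pure parity. -/
def IsParitySymm {k : ℕ} (f : MultilinearMap K (fun _ : Fin k => V) W) : Prop :=
  ∀ (σ : Equiv.Perm (Fin k)) (q : Fin k → ZMod 2) (y : Fin k → V),
    (∀ i, parityPart 𝒱 (q i) (y i) = y i) → f (fun i => y (σ i)) = koszulSign σ q • f y

variable {𝒱} in
theorem IsParitySymm.isGradedSymm {k : ℕ} {f : MultilinearMap K (fun _ : Fin k => V) W}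
    (hf : IsParitySymm 𝒱 f) : IsGradedSymm 𝒱 f :=
  fun σ _ x hx => hf σ _ x fun i => parityPart_self_of_mem 𝒱 (hx i)

/-- Every parity pattern other than `q` projects some entry to zero. -/
theorem koszulSum_of_parity {W : Type*} [AddCommGroup W] {k : ℕ}
    (F : Equiv.Perm (Fin k) → (Fin k → V) → W) (hF : ∀ σ y i, y i = 0 → F σ y = 0)
    (q : Fin k → ZMod 2) (x : Fin k → V) (hx : ∀ i, parityPart 𝒱 (q i) (x i) = x i) :
    koszulSum 𝒱 F x = ∑ σ : Equiv.Perm (Fin k), koszulSign σ q • F σ (fun i => x (σ i)) := by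
  unfold koszulSum
  rw [Finset.sum_eq_single q]
  · refine Finset.sum_congr rfl fun σ _ => ?_
    congr 2
    funext i
    exact hx (σ i)
  · intro p _ hp
    obtain ⟨j, hj⟩ := Function.ne_iff.mp hp
    refine Finset.sum_eq_zero fun σ _ => ?_
    rw [hF σ _ (σ.symm j), smul_zero]
    rw [Equiv.apply_symm_apply, parityPart_of_ne 𝒱 hj (hx j)]
  · simp

theorem symmetrize_of_parity (f : Ops K V W) (k : ℕ) (q : Fin (k + 1) → ZMod 2)
    (y : Fin (k + 1) → V) (hy : ∀ i, parityPart 𝒱 (q i) (y i) = y i) :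
    symmetrize 𝒱 f k y = ∑ σ, koszulSign σ q • f k (fun i => y (σ i)) := by
  rw [symmetrize, koszulSumMap_apply, koszulSum_of_parity 𝒱 _ _ q y hy]
  intro σ y i hi
  exact (f k).map_coord_zero i hi

/-- Substitute `σ ↦ τ * σ`; the cocycle rule then produces `ε(τ)` twice, and it cancels. -/
theorem symmetrize_isParitySymm (f : Ops K V W) (k : ℕ) :
    IsParitySymm 𝒱 (symmetrize 𝒱 f k) := by
  intro τ q y hy
  rw [symmetrize_of_parity 𝒱 f k (fun i => q (τ i)) _ fun i => hy (τ i),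
    symmetrize_of_parity 𝒱 f k q y hy, Finset.smul_sum]
  symm
  rw [← Equiv.sum_comp (Equiv.mulLeft τ)]
  refine Finset.sum_congr rfl fun σ _ => ?_
  rw [Equiv.coe_mulLeft, koszulSign_mul, smul_smul, ← mul_assoc, koszulSign_mul_self, one_mul]
  rfl

variable {𝒱 𝒲} in
theorem HasParity.symmetrize {n : ZMod 2} {f : Ops K V W} (hf : ∀ k, HasParity 𝒱 𝒲 n (f k)) (k : ℕ) :
    HasParity 𝒱 𝒲 n (symmetrize 𝒱 f k) := by
  intro q y hy
  rw [symmetrize_of_parity 𝒱 f k q y hy, map_sum]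
  refine Finset.sum_congr rfl fun σ _ => ?_
  rw [map_zsmul]
  congr 1
  have := hf k (fun i => q (σ i)) (fun i => y (σ i)) fun i => hy (σ i)
  rwa [Equiv.sum_comp σ q] at this

omit [DirectSum.Decomposition 𝒲] in
variable {𝒱 𝒲} in
theorem HasDegree.symmetrize {n : ℤ} {f : Ops K V W} (hf : ∀ k, HasDegree 𝒱 𝒲 n (f k)) (k : ℕ) :
    HasDegree 𝒱 𝒲 n (symmetrize 𝒱 f k) := by
  intro d x hx
  rw [symmetrize_of_parity 𝒱 f k _ x fun i => parityPart_self_of_mem 𝒱 (hx i)]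
  refine Submodule.sum_mem _ fun σ _ => ?_
  have := hf k (fun i => d (σ i)) (fun i => x (σ i)) fun i => hx (σ i)
  rw [Equiv.sum_comp σ d] at this
  exact zsmul_mem this _

end Parity

/-! ### Parities on `A ⊕ M` are computed componentwise. -/

section ProdParity

variable {K : Type*} [Field K] {A M : Type*} [AddCommGroup A] [Module K A]
  [AddCommGroup M] [Module K M]
  (𝒜 : ℤ → Submodule K A) [DirectSum.Decomposition 𝒜]
  (ℳ : ℤ → Submodule K M) [DirectSum.Decomposition ℳ]

theorem parityPart_prod (p : ZMod 2) (x : A × M) :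
    parityPart (prodGrading 𝒜 ℳ) p x = (parityPart 𝒜 p x.1, parityPart ℳ p x.2) := by
  refine Prod.ext ?_ ?_
  · exact (parityPart_map (𝒱 := prodGrading 𝒜 ℳ) (𝒲 := 𝒜) (LinearMap.fst K A M)
      (fun i v hv => hv.1) p x).symm
  · exact (parityPart_map (𝒱 := prodGrading 𝒜 ℳ) (𝒲 := ℳ) (LinearMap.snd K A M)
      (fun i v hv => hv.2) p x).symm

theorem sgn_prod (n : ℤ) (x : A × M) :
    sgn (prodGrading 𝒜 ℳ) n x = (sgn 𝒜 n x.1, sgn ℳ n x.2) := by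
  refine Prod.ext ?_ ?_
  · exact (sgn_map (𝒱 := prodGrading 𝒜 ℳ) (𝒲 := 𝒜) (LinearMap.fst K A M)
      (fun i v hv => hv.1) n x).symm
  · exact (sgn_map (𝒱 := prodGrading 𝒜 ℳ) (𝒲 := ℳ) (LinearMap.snd K A M)
      (fun i v hv => hv.2) n x).symm

end ProdParity

/-! ### Permutations of an interval and rotations of a block. -/

section BlockPermutations

theorem val_ofNat {N j : ℕ} (h : j ≤ N) : (Fin.ofNat (N + 1) j).val = j :=
  Nat.mod_eq_of_lt (Nat.lt_succ_of_le h)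

theorem ofNat_eq_iff {N j : ℕ} (h : j ≤ N) {a : Fin (N + 1)} :
    Fin.ofNat (N + 1) j = a ↔ j = a.val := by
  rw [Fin.ext_iff, val_ofNat h]

/-- The permutation of `{0, …, n - 1}` given by `τ` on the interval `[a, a + m)`. -/
def extendPerm (a : ℕ) {m n : ℕ} (h : a + m ≤ n) (τ : Equiv.Perm (Fin m)) : Equiv.Perm (Fin n) :=
  τ.viaFintypeEmbedding ⟨fun r => ⟨a + r.val, by omega⟩, fun r s hrs => by
    simpa [Fin.ext_iff] using hrs⟩

theorem extendPerm_apply (a : ℕ) {m n : ℕ} (h : a + m ≤ n) (τ : Equiv.Perm (Fin m)) (r : Fin m)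
    (j : Fin n) (hj : j.val = a + r.val) : (extendPerm a h τ j).val = a + (τ r).val := by
  have : j = (⟨fun r => ⟨a + r.val, by omega⟩, fun r s hrs => by
    simpa [Fin.ext_iff] using hrs⟩ : Fin m ↪ Fin n) r := Fin.ext hj
  rw [this, extendPerm, Equiv.Perm.viaFintypeEmbedding_apply_image]
  rfl

theorem extendPerm_apply_of_notMem (a : ℕ) {m n : ℕ} (h : a + m ≤ n) (τ : Equiv.Perm (Fin m))
    (j : Fin n) (hj : j.val < a ∨ a + m ≤ j.val) : extendPerm a h τ j = j := by
  rw [extendPerm, Equiv.Perm.viaFintypeEmbedding_apply_notMem_range]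
  rintro ⟨r, rfl⟩
  have := r.isLt
  have hj' : a + r.val < a ∨ a + m ≤ a + r.val := hj
  omega

theorem koszulSign_extendPerm (a : ℕ) {m n : ℕ} (h : a + m ≤ n) (τ : Equiv.Perm (Fin m))
    (p : Fin n → ZMod 2) :
    koszulSign (extendPerm a h τ) p = koszulSign τ (fun r => p ⟨a + r.val, by omega⟩) := by
  have hr : ∀ j : Fin n, j ∉ Set.range (fun r : Fin m => (⟨a + r.val, by omega⟩ : Fin n)) →
      j.val < a ∨ a + m ≤ j.val := by
    intro j hj
    by_contra! hc
    exact hj ⟨⟨j.val - a, by omega⟩, Fin.ext (by simp; omega)⟩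
  refine koszulSign_extend (fun r : Fin m => (⟨a + r.val, by omega⟩ : Fin n)) ?_ ?_ τ _ ?_ ?_ p
  · intro r s hrs
    simpa using hrs
  · intro j hj
    rcases hr j hj with h1 | h1
    · right; intro r; simp only [Fin.lt_def]; omega
    · left; intro r; simp only [Fin.lt_def]; omega
  · intro r
    exact Fin.ext (extendPerm_apply a h τ r _ rfl)
  · intro j hj
    exact extendPerm_apply_of_notMem a h τ j (hr j hj)

theorem extendPerm_swap (a : ℕ) {m n : ℕ} (h : a + m ≤ n) (r s : Fin m) (i j : Fin n)
    (hi : i.val = a + r.val) (hj : j.val = a + s.val) :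
    extendPerm a h (Equiv.swap r s) = Equiv.swap i j := by
  ext x
  by_cases hx : x.val < a ∨ a + m ≤ x.val
  · rw [extendPerm_apply_of_notMem a h _ x hx, Equiv.swap_apply_of_ne_of_ne]
    · rintro rfl; omega
    · rintro rfl; omega
  · have hx' : x.val = a + (⟨x.val - a, by omega⟩ : Fin m).val := by simp; omega
    rw [extendPerm_apply a h _ _ x hx']
    simp only [Equiv.swap_apply_def, Fin.ext_iff]
    split_ifs <;> simp at * <;> omega

theorem extendPerm_injective (a : ℕ) {m n : ℕ} (h : a + m ≤ n) :
    Function.Injective (extendPerm a h) := by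
  intro τ τ' hτ
  ext r
  have h1 := extendPerm_apply a h τ r ⟨a + r.val, by omega⟩ rfl
  rw [hτ, extendPerm_apply a h τ' r _ rfl] at h1
  omega

/-- The permutation moving the block `[0, l]` behind the `i` entries following it. -/
def blockRot {k l N : ℕ} (h : k + l = N) (i : Fin (k + 1)) : Equiv.Perm (Fin (N + 1)) where
  toFun a := Fin.ofNat (N + 1) (if a.val < i.val then l + 1 + a.val
    else if a.val ≤ i.val + l then a.val - i.val else a.val)
  invFun a := Fin.ofNat (N + 1) (if a.val ≤ l then a.val + i.val
    else if a.val ≤ l + i.val then a.val - (l + 1) else a.val)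
  left_inv a := by
    have h1 : (if a.val < i.val then l + 1 + a.val
      else if a.val ≤ i.val + l then a.val - i.val else a.val) ≤ N := by split_ifs <;> omega
    rw [ofNat_eq_iff, val_ofNat h1]
    · split_ifs <;> omega
    · rw [val_ofNat h1]; split_ifs <;> omega
  right_inv a := by
    have h1 : (if a.val ≤ l then a.val + i.val
      else if a.val ≤ l + i.val then a.val - (l + 1) else a.val) ≤ N := by split_ifs <;> omega
    rw [ofNat_eq_iff, val_ofNat h1]
    · split_ifs <;> omega
    · rw [val_ofNat h1]; split_ifs <;> omega

theorem blockRot_val {k l N : ℕ} (h : k + l = N) (i : Fin (k + 1)) (a : Fin (N + 1)) :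
    (blockRot h i a).val = if a.val < i.val then l + 1 + a.val
      else if a.val ≤ i.val + l then a.val - i.val else a.val :=
  val_ofNat (by split_ifs <;> omega)

theorem koszulSign_blockRot {k l N : ℕ} (h : k + l = N) (i : Fin (k + 1)) (p : Fin (N + 1) → ZMod 2) :
    koszulSign (blockRot h i) p =
      paritySign ((∑ a : Fin (N + 1), if a.val < i.val then p (blockRot h i a) else 0) *
        ∑ r : Fin (l + 1), p (Fin.ofNat (N + 1) r.val)) := by
  rw [koszulSign_of_inversions (blockRot h i) i.val (i.val + l + 1)]
  · congr 2
    symm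
    refine Fintype.sum_of_injective (fun r : Fin (l + 1) => (⟨i.val + r.val, by omega⟩ : Fin (N + 1)))
      ?_ _ _ ?_ ?_
    · intro r s hrs
      simpa [Fin.ext_iff] using hrs
    · intro b hb
      refine if_neg fun hc => hb ⟨⟨b.val - i.val, by omega⟩, Fin.ext ?_⟩
      simp only
      omega
    · intro r
      rw [if_pos (by simp only; omega)]
      congr 1
      rw [ofNat_eq_iff (by omega), blockRot_val]
      simp only
      split_ifs <;> omega
  · intro a b
    simp only [Fin.lt_def, blockRot_val]
    split_ifs <;> omega

/-- A permutation is classified by the position `i` that it sends to `0` and by a bijection of the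
rest. Given injectivity, `(k + 1) * k! = (k + 1)!` shows that all of them are reached. -/
theorem sum_perm_succ {W : Type*} [AddCommMonoid W] (k : ℕ) (H : Equiv.Perm (Fin (k + 1)) → W) :
    ∑ π, H π = ∑ i : Fin (k + 1), ∑ e : Equiv.Perm (Fin k),
      H (extendPerm 1 (by omega) e * blockRot (l := 0) rfl i) := by
  rw [← Fintype.sum_prod_type']
  symm
  refine Fintype.sum_bijective
    (fun x : Fin (k + 1) × Equiv.Perm (Fin k) =>
      extendPerm 1 (by omega) x.2 * blockRot (l := 0) rfl x.1) ?_ _ _ fun x => rfl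
  rw [Fintype.bijective_iff_injective_and_card]
  refine ⟨?_, ?_⟩
  · rintro ⟨i, e⟩ ⟨i', e'⟩ he
    have h0 : ∀ (i : Fin (k + 1)) (e : Equiv.Perm (Fin k)),
        (extendPerm 1 (by omega) e * blockRot (l := 0) rfl i : Equiv.Perm (Fin (k + 1))) i = 0 := by
      intro i e
      have : blockRot (l := 0) rfl i i = (0 : Fin (k + 1)) := Fin.ext (by rw [blockRot_val]; simp)
      rw [Equiv.Perm.mul_apply, this]
      exact extendPerm_apply_of_notMem 1 _ e 0 (Or.inl (by simp))
    have hi : i = i' := by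
      have h1 := h0 i' e'
      simp only at he
      rw [← he, ← h0 i e] at h1
      exact ((Equiv.injective _) h1).symm
    subst hi
    have := extendPerm_injective 1 _ (mul_right_cancel he)
    exact Prod.ext rfl this
  · simp [Fintype.card_perm, Nat.factorial_succ]

theorem card_interval {n s t : ℕ} (h : t ≤ n) :
    Fintype.card {a : Fin n // s ≤ a.val ∧ a.val < t} = t - s := by
  rw [← Fintype.card_fin (t - s)]
  refine Fintype.card_congr
    { toFun := fun a => ⟨a.1.val - s, by have := a.2; omega⟩
      invFun := fun r => ⟨⟨s + r.val, by omega⟩, by simp only; omega⟩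
      left_inv := ?_
      right_inv := ?_ }
  · rintro ⟨a, ha⟩
    apply Subtype.ext
    apply Fin.ext
    simp only
    omega
  · intro r
    apply Fin.ext
    simp

/-- The substitution `σ ↦ σ * τ` absorbs the second sign by the cocycle rule. Inner permutations,
outer permutations and rotations are removed from the double sums below in this way. -/
theorem sum_koszulSign_comp {n : ℕ} {W : Type*} [AddCommGroup W] (q : Fin n → ZMod 2)
    (τ : Equiv.Perm (Fin n)) (Φ : Equiv.Perm (Fin n) → W) :
    ∑ σ, koszulSign σ q • koszulSign τ (fun i => q (σ i)) • Φ (σ * τ) = ∑ σ, koszulSign σ q • Φ σ := by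
  symm
  rw [← Equiv.sum_comp (Equiv.mulRight τ)]
  refine Finset.sum_congr rfl fun σ _ => ?_
  rw [Equiv.coe_mulRight, koszulSign_mul, smul_smul]

end BlockPermutations

/-! ### Permuting the arguments of a composition. -/

section InsertAt

variable {K : Type*} [Field K] {V W : Type*} [AddCommGroup V] [Module K V]
  [AddCommGroup W] [Module K W]

theorem map_zsmul_univ {k : ℕ} (f : MultilinearMap K (fun _ : Fin k => V) W) (c : Fin k → ℤ)
    (v : Fin k → V) : f (fun j => c j • v j) = (∏ j, c j) • f v := by
  simp only [← Int.cast_smul_eq_zsmul K]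
  rw [f.map_smul_univ, Int.cast_prod]

omit [AddCommGroup V] in
theorem insertAt_zero {s : V → V} (k l N : ℕ) (g : (Fin (l + 1) → V) → V) (x : Fin (N + 1) → V) :
    insertAt s k l N 0 g x = fun j : Fin (k + 1) => if j.val = 0 then
      g (fun r => x (Fin.ofNat (N + 1) r.val)) else x (Fin.ofNat (N + 1) (j.val + l)) := by
  funext j
  simp [insertAt]

theorem insertAt_eq_update (s : V → V) (k l N : ℕ) (i : Fin (k + 1)) (g : (Fin (l + 1) → V) → V)
    (x : Fin (N + 1) → V) :
    insertAt s k l N i.val g x = Function.update (insertAt s k l N i.val (fun _ => 0) x) i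
      (g fun r => x (Fin.ofNat (N + 1) (i.val + r.val))) := by
  funext j
  by_cases h : j = i
  · subst h
    simp [insertAt]
  · rw [Function.update_of_ne h]
    have h' : j.val ≠ i.val := fun h' => h (Fin.ext h')
    simp [insertAt, h']

theorem map_insertAt_sum (f : MultilinearMap K (fun _ : Fin (k + 1) => V) W) (s : V → V) (l N : ℕ)
    (i : Fin (k + 1)) {ι : Type*} (t : Finset ι) (c : ι → ℤ) (g : ι → (Fin (l + 1) → V) → V)
    (x : Fin (N + 1) → V) :
    f (insertAt s k l N i.val (fun v => ∑ a ∈ t, c a • g a v) x) =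
      ∑ a ∈ t, c a • f (insertAt s k l N i.val (g a) x) := by
  rw [insertAt_eq_update]
  have := map_sum (f.toLinearMap (insertAt s k l N i.val (fun _ => 0) x) i)
    (fun a => c a • g a fun r => x (Fin.ofNat (N + 1) (i.val + r.val))) t
  rw [f.toLinearMap_apply] at this
  rw [this]
  refine Finset.sum_congr rfl fun a _ => ?_
  rw [map_zsmul, f.toLinearMap_apply, ← insertAt_eq_update]

theorem map_insertAt_smul (f : MultilinearMap K (fun _ : Fin (k + 1) => V) W) (s : V → V) (l N : ℕ)
    (i : Fin (k + 1)) (c : ℤ) (g : (Fin (l + 1) → V) → V) (x : Fin (N + 1) → V) :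
    f (insertAt s k l N i.val (fun v => c • g v) x) = c • f (insertAt s k l N i.val g x) := by
  have := map_insertAt_sum f s l N i (Finset.univ : Finset Unit) (fun _ => c) (fun _ => g) x
  simpa using this

omit [AddCommGroup V] in
theorem insertAt_congr (s : V → V) (k l N i : ℕ) {g g' : (Fin (l + 1) → V) → V}
    (x : Fin (N + 1) → V) (h : g (fun r => x (Fin.ofNat (N + 1) (i + r.val))) =
      g' (fun r => x (Fin.ofNat (N + 1) (i + r.val)))) :
    insertAt s k l N i g x = insertAt s k l N i g' x := by
  funext j
  simp only [insertAt, h]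

omit [AddCommGroup V] in
theorem insertAt_zero_comp_inner {k l N : ℕ} (h : k + l = N) (g : (Fin (l + 1) → V) → V)
    (τ : Equiv.Perm (Fin (l + 1))) (x : Fin (N + 1) → V) :
    insertAt id k l N 0 g (fun j => x (extendPerm 0 (by omega) τ j)) =
      insertAt id k l N 0 (fun v => g fun r => v (τ r)) x := by
  rw [insertAt_zero, insertAt_zero]
  funext j
  split_ifs with hj
  · congr 1
    funext r
    congr 1
    apply Fin.ext
    rw [extendPerm_apply 0 _ τ r _ (by rw [val_ofNat (by omega)]; omega), val_ofNat (by omega)]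
    omega
  · rw [extendPerm_apply_of_notMem]
    right
    rw [val_ofNat (by omega)]
    omega

omit [AddCommGroup V] in
theorem insertAt_zero_comp_outer {k l N : ℕ} (h : k + l = N) (g : (Fin (l + 1) → V) → V)
    (e : Equiv.Perm (Fin k)) (x : Fin (N + 1) → V) :
    insertAt id k l N 0 g (fun j => x (extendPerm (l + 1) (by omega) e j)) =
      fun j => insertAt id k l N 0 g x (extendPerm 1 (by omega) e j) := by
  rw [insertAt_zero, insertAt_zero]
  funext j
  dsimp only
  by_cases hj : j.val = 0
  · have : extendPerm 1 (show 1 + k ≤ k + 1 by omega) e j = j :=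
      extendPerm_apply_of_notMem 1 _ e j (Or.inl (by omega))
    rw [if_pos hj, this, if_pos hj]
    congr 1
    funext r
    rw [extendPerm_apply_of_notMem]
    left
    rw [val_ofNat (by omega)]
    omega
  · have h1 : (extendPerm 1 (show 1 + k ≤ k + 1 by omega) e j).val = 1 + (e ⟨j.val - 1, by omega⟩).val :=
      extendPerm_apply 1 _ e _ j (by simp; omega)
    rw [if_neg hj, if_neg (by omega)]
    congr 1
    symm
    rw [ofNat_eq_iff (by omega), h1, extendPerm_apply (l + 1) _ e ⟨j.val - 1, by omega⟩]
    · omega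
    · rw [val_ofNat (by omega)]; simp; omega

/-- The parities of the entries of `insertAt id k l N 0 g x`, for `g` of parity `n` and `x` of
parities `q`. -/
def insertParity (n : ZMod 2) (k l N : ℕ) (q : Fin (N + 1) → ZMod 2) : Fin (k + 1) → ZMod 2 :=
  fun j => if j.val = 0 then (∑ r : Fin (l + 1), q (Fin.ofNat (N + 1) r.val)) + n
    else q (Fin.ofNat (N + 1) (j.val + l))

theorem koszulSign_extendPerm_insertParity {k l N : ℕ} (h : k + l = N) (n : ZMod 2)
    (q : Fin (N + 1) → ZMod 2) (e : Equiv.Perm (Fin k)) :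
    koszulSign (extendPerm (n := k + 1) 1 (by omega) e) (insertParity n k l N q) =
      koszulSign (extendPerm (n := N + 1) (l + 1) (by omega) e) q := by
  rw [koszulSign_extendPerm, koszulSign_extendPerm]
  congr 1
  funext r
  simp only [insertParity]
  rw [if_neg (by omega)]
  congr 1
  rw [ofNat_eq_iff (by omega)]
  simp only
  omega

variable (𝒱 : ℤ → Submodule K V) [DirectSum.Decomposition 𝒱]

theorem insertAt_zero_parity (k l N : ℕ) {n : ZMod 2}
    {g : MultilinearMap K (fun _ : Fin (l + 1) => V) V} (hg : HasParity 𝒱 𝒱 n g)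
    {q : Fin (N + 1) → ZMod 2} {y : Fin (N + 1) → V} (hy : ∀ i, parityPart 𝒱 (q i) (y i) = y i)
    (j : Fin (k + 1)) : parityPart 𝒱 (insertParity n k l N q j) (insertAt id k l N 0 g y j) =
      insertAt id k l N 0 g y j := by
  rw [insertAt_zero]
  simp only [insertParity]
  split_ifs with hj
  · exact hg _ _ fun r => hy _
  · exact hy _

/-- Moving an inserted operation of degree `n` from the front to position `i`. -/
theorem map_insertAt_blockRot {k l N : ℕ} (h : k + l = N) (i : Fin (k + 1)) {n : ℤ}
    (f : MultilinearMap K (fun _ : Fin (k + 1) => V) W)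
    {g : MultilinearMap K (fun _ : Fin (l + 1) => V) V}
    {q : Fin (N + 1) → ZMod 2} {y : Fin (N + 1) → V} (hy : ∀ i, parityPart 𝒱 (q i) (y i) = y i) :
    koszulSign (blockRot h i) q • f (insertAt (sgn 𝒱 n) k l N i.val g fun j => y (blockRot h i j)) =
      koszulSign (blockRot (l := 0) rfl i) (insertParity n k l N q) •
        f (fun j => insertAt id k l N 0 g y (blockRot (l := 0) rfl i j)) := by
  -- `sgn` affects only the `i` entries in front of the inserted operation, each through the sign
  -- `(-1)^{n |x|}`.
  have e1 : (insertAt (sgn 𝒱 n) k l N i.val g fun j => y (blockRot h i j)) =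
      fun j : Fin (k + 1) => (if j.val < i.val then
        paritySign (n * insertParity n k l N q (blockRot (l := 0) rfl i j)) else 1) •
          insertAt id k l N 0 g y (blockRot (l := 0) rfl i j) := by
    funext j
    rw [insertAt_zero]
    simp only [insertAt, insertParity]
    by_cases h1 : j.val < i.val
    · have hc : (blockRot (l := 0) rfl i j).val = j.val + 1 := by
        rw [blockRot_val, if_pos h1]; omega
      have e2 : blockRot h i (Fin.ofNat (N + 1) j.val) = Fin.ofNat (N + 1) (j.val + 1 + l) := by
        apply Fin.ext
        rw [blockRot_val, val_ofNat (by omega), val_ofNat (by omega), if_pos h1]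
        omega
      rw [hc, if_pos h1, if_pos h1, if_neg (by omega), if_neg (by omega), e2, sgn_of_parity 𝒱 n (hy _)]
    · by_cases h2 : j.val = i.val
      · have hc : (blockRot (l := 0) rfl i j).val = 0 := by
          rw [blockRot_val, if_neg h1, if_pos (by omega)]; omega
        rw [if_neg h1, if_pos h2, if_neg h1, if_pos hc, one_smul]
        congr 1
        funext r
        congr 1
        apply Fin.ext
        rw [blockRot_val, val_ofNat (by omega), val_ofNat (by omega)]
        split_ifs <;> omega
      · have hc : (blockRot (l := 0) rfl i j).val = j.val := by
          rw [blockRot_val, if_neg h1, if_neg (by omega)]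
        rw [if_neg h1, if_neg h2, if_neg h1, hc, if_neg (by omega), one_smul]
        congr 1
        apply Fin.ext
        rw [blockRot_val, val_ofNat (by omega), if_neg (by omega), if_neg (by omega)]

  have e3 : ∏ j : Fin (k + 1), (if j.val < i.val then
      paritySign (n * insertParity n k l N q (blockRot (l := 0) rfl i j)) else 1) =
      paritySign (n * ∑ j : Fin (k + 1), if j.val < i.val then
        insertParity n k l N q (blockRot (l := 0) rfl i j) else 0) := by
    rw [Finset.mul_sum, paritySign_sum]
    refine Finset.prod_congr rfl fun j _ => ?_
    split_ifs
    · rfl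
    · rw [mul_zero, paritySign_zero]
  have e4 : (∑ a : Fin (N + 1), if a.val < i.val then q (blockRot h i a) else 0) =
      ∑ j : Fin (k + 1), if j.val < i.val then
        insertParity n k l N q (blockRot (l := 0) rfl i j) else 0 := by
    symm
    refine Fintype.sum_of_injective (Fin.castLE (show k + 1 ≤ N + 1 by omega))
      (Fin.castLE_injective _) _ _ ?_ ?_
    · intro a ha
      refine if_neg fun hc => ha ⟨⟨a.val, by omega⟩, rfl⟩
    · intro j
      simp only [Fin.val_castLE]
      split_ifs with hj
      · simp only [insertParity, blockRot_val, hj, if_true]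
        rw [if_neg (by omega)]
        congr 1
        rw [ofNat_eq_iff (by omega), blockRot_val, Fin.val_castLE, if_pos hj]
        omega
      · rfl
  rw [e1, map_zsmul_univ, e3, smul_smul, koszulSign_blockRot, koszulSign_blockRot, e4]
  congr 1
  rw [← paritySign_add]
  congr 1
  -- The outer rotation moves a single entry, whose parity is that of the whole block plus `n`. This
  -- extra `n` is what matches the signs coming from `sgn`.
  have e5 : (∑ r : Fin (0 + 1), insertParity n k l N q (Fin.ofNat (k + 1) r.val)) =
      (∑ r : Fin (l + 1), q (Fin.ofNat (N + 1) r.val)) + n := by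
    simp [insertParity]
  rw [e5]
  ring

end InsertAt

/-! ### Symmetrization is compatible with circle products. -/

section Symmetrization

variable {K : Type*} [Field K] {V W : Type*} [AddCommGroup V] [Module K V]
  [AddCommGroup W] [Module K W]
  (𝒱 : ℤ → Submodule K V) [DirectSum.Decomposition 𝒱]

theorem insertParity_eq_insertAt (n : ZMod 2) (k l N : ℕ) (q : Fin (N + 1) → ZMod 2) :
    insertParity n k l N q = insertAt id k l N 0 (fun v : Fin (l + 1) → ZMod 2 => (∑ r, v r) + n) q := by
  rw [insertAt_zero]
  rfl

/-- Linearity in the inserted slot pulls the inner sum out; inner permutations become permutations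
of all arguments that move only the first `l + 1` positions. -/
theorem map_insertAt_symmetrize {k l N : ℕ} (h : k + l = N)
    (f : MultilinearMap K (fun _ : Fin (k + 1) => V) W) (G : Ops K V V)
    {q : Fin (N + 1) → ZMod 2} {y : Fin (N + 1) → V} (hy : ∀ i, parityPart 𝒱 (q i) (y i) = y i) :
    f (insertAt id k l N 0 (symmetrize 𝒱 G l) y) =
      ∑ τ : Equiv.Perm (Fin (l + 1)), koszulSign (extendPerm 0 (by omega) τ) q •
        f (insertAt id k l N 0 (G l) fun j => y (extendPerm 0 (by omega) τ j)) := by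
  rw [insertAt_congr (g := symmetrize 𝒱 G l) (g' := fun v => ∑ τ : Equiv.Perm (Fin (l + 1)),
    koszulSign (extendPerm (n := N + 1) 0 (by omega) τ) q • G l (fun r => v (τ r)))]
  · have := map_insertAt_sum f id l N 0 Finset.univ
      (fun τ : Equiv.Perm (Fin (l + 1)) => koszulSign (extendPerm (n := N + 1) 0 (by omega) τ) q)
      (fun τ v => G l (fun r => v (τ r))) y
    rw [Fin.val_zero] at this
    rw [this]
    refine Finset.sum_congr rfl fun τ _ => ?_
    rw [insertAt_zero_comp_inner h]
  · rw [symmetrize_of_parity 𝒱 G l (fun r => q (Fin.ofNat (N + 1) (0 + r.val))) _ fun r => hy _]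
    refine Finset.sum_congr rfl fun τ _ => ?_
    rw [koszulSign_extendPerm]
    congr 2
    funext r
    congr 1
    rw [ofNat_eq_iff (by omega)]

/-- The outer permutations are sorted by the slot `i` that receives the inserted value
(`sum_perm_succ`). The rotation to that slot creates the operator sign of the unsymmetrized circle
product. -/
theorem symmetrize_insertAt {k l N : ℕ} (h : k + l = N) {n : ℤ} (F : Ops K V W)
    {g : MultilinearMap K (fun _ : Fin (l + 1) => V) V} (hg : HasParity 𝒱 𝒱 (n : ZMod 2) g)
    {q : Fin (N + 1) → ZMod 2} {y : Fin (N + 1) → V} (hy : ∀ i, parityPart 𝒱 (q i) (y i) = y i) :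
    symmetrize 𝒱 F k (insertAt id k l N 0 g y) =
      ∑ i : Fin (k + 1), ∑ e : Equiv.Perm (Fin k), koszulSign (extendPerm (l + 1) (by omega) e) q •
        koszulSign (blockRot h i) (fun j => q (extendPerm (l + 1) (by omega) e j)) •
          F k (insertAt (sgn 𝒱 n) k l N i.val g fun j =>
            y (extendPerm (l + 1) (by omega) e (blockRot h i j))) := by
  rw [symmetrize_of_parity 𝒱 F k _ _ (insertAt_zero_parity 𝒱 k l N hg hy), sum_perm_succ]
  refine Finset.sum_congr rfl fun i _ => Finset.sum_congr rfl fun e _ => ?_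
  have h1 := map_insertAt_blockRot 𝒱 h i (n := n) (F k) (g := g)
    (q := fun j => q (extendPerm (l + 1) (by omega) e j))
    (y := fun j => y (extendPerm (l + 1) (by omega) e j)) fun j => hy _
  rw [h1, koszulSign_mul, koszulSign_extendPerm_insertParity h, mul_smul,
    insertAt_zero_comp_outer h, insertParity_eq_insertAt, insertParity_eq_insertAt,
    insertAt_zero_comp_outer h]
  rfl

/-- Inserting symmetrized operations into each other and summing over all permutations. -/
theorem sum_symmetrize_insertAt {k l N : ℕ} (h : k + l = N) {n : ℤ} (F : Ops K V W) (G : Ops K V V)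
    (hG : HasParity 𝒱 𝒱 (n : ZMod 2) (G l))
    {q : Fin (N + 1) → ZMod 2} {z : Fin (N + 1) → V} (hz : ∀ i, parityPart 𝒱 (q i) (z i) = z i) :
    ∑ σ : Equiv.Perm (Fin (N + 1)), koszulSign σ q •
        symmetrize 𝒱 F k (insertAt id k l N 0 (symmetrize 𝒱 G l) fun j => z (σ j)) =
      ((l + 1).factorial * k.factorial) • ∑ σ : Equiv.Perm (Fin (N + 1)), koszulSign σ q •
        ∑ i : Fin (k + 1), F k (insertAt (sgn 𝒱 n) k l N i.val (G l) fun j => z (σ j)) := by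
  have e1 : ∀ σ : Equiv.Perm (Fin (N + 1)), symmetrize 𝒱 F k (insertAt id k l N 0 (symmetrize 𝒱 G l)
      fun j => z (σ j)) = ∑ τ : Equiv.Perm (Fin (l + 1)),
        koszulSign (extendPerm 0 (by omega) τ) (fun j => q (σ j)) •
        (fun ρ : Equiv.Perm (Fin (N + 1)) => symmetrize 𝒱 F k (insertAt id k l N 0 (G l)
          fun j => z (ρ j))) (σ * extendPerm 0 (by omega) τ) := fun σ =>
    map_insertAt_symmetrize 𝒱 h _ G fun j => hz (σ j)
  have e2 : ∀ σ : Equiv.Perm (Fin (N + 1)), symmetrize 𝒱 F k (insertAt id k l N 0 (G l)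
      fun j => z (σ j)) = ∑ i : Fin (k + 1), ∑ e : Equiv.Perm (Fin k),
        koszulSign (extendPerm (l + 1) (by omega) e) (fun j => q (σ j)) •
        (fun ρ : Equiv.Perm (Fin (N + 1)) => koszulSign (blockRot h i) (fun j => q (ρ j)) •
          (fun π : Equiv.Perm (Fin (N + 1)) => F k (insertAt (sgn 𝒱 n) k l N i.val (G l)
            fun j => z (π j))) (ρ * blockRot h i)) (σ * extendPerm (l + 1) (by omega) e) := fun σ =>
    symmetrize_insertAt 𝒱 h F hG fun j => hz (σ j)
  rw [mul_smul]
  conv_lhs => simp only [e1, Finset.smul_sum]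
  -- After reindexing `σ`, all inner permutations contribute equally, which gives the factor `(l +
  -- 1)!`. The outer permutations give `k!` in the same way further down.
  rw [Finset.sum_comm,
    Finset.sum_congr rfl fun (τ : Equiv.Perm (Fin (l + 1))) _ => sum_koszulSign_comp q
    (extendPerm (n := N + 1) 0 (by omega) τ) (fun ρ : Equiv.Perm (Fin (N + 1)) =>
      symmetrize 𝒱 F k (insertAt id k l N 0 (G l) fun j => z (ρ j))),
    Finset.sum_const, Finset.card_univ, Fintype.card_perm, Fintype.card_fin]
  congr 1
  simp only [e2, Finset.smul_sum]
  rw [Finset.sum_comm]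
  conv_rhs => rw [Finset.sum_comm]
  refine Finset.sum_congr rfl fun i _ => ?_
  rw [Finset.sum_comm]
  have e3 : ∀ e : Equiv.Perm (Fin k), _ := fun e => sum_koszulSign_comp q
    (extendPerm (n := N + 1) (l + 1) (by omega) e)
    (fun ρ : Equiv.Perm (Fin (N + 1)) => koszulSign (blockRot h i) (fun j => q (ρ j)) •
          (fun π : Equiv.Perm (Fin (N + 1)) => F k (insertAt (sgn 𝒱 n) k l N i.val (G l)
            fun j => z (π j))) (ρ * blockRot h i))
  rw [Finset.sum_congr rfl fun e _ => e3 e, Finset.sum_const, Finset.card_univ,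
    Fintype.card_perm, Fintype.card_fin, sum_koszulSign_comp q (blockRot h i)
      (fun π : Equiv.Perm (Fin (N + 1)) => F k (insertAt (sgn 𝒱 n) k l N i.val (G l)
        fun j => z (π j))), Finset.smul_sum]

/-- Two operations `g`, `g'` are allowed because an inner permutation may move a distinguished slot,
turning one `dendOfRRB ρ T m t` into another. -/
theorem map_insertAt_inner {k l N : ℕ} (h : k + l = N)
    (f : MultilinearMap K (fun _ : Fin (k + 1) => V) W)
    (g g' : MultilinearMap K (fun _ : Fin (l + 1) => V) V) (τ : Equiv.Perm (Fin (l + 1)))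
    (hτ : ∀ (p : Fin (l + 1) → ZMod 2) v, (∀ i, parityPart 𝒱 (p i) (v i) = v i) →
      g (fun r => v (τ r)) = koszulSign τ p • g' v)
    {q : Fin (N + 1) → ZMod 2} {y : Fin (N + 1) → V} (hy : ∀ i, parityPart 𝒱 (q i) (y i) = y i) :
    koszulSign (extendPerm 0 (by omega) τ) q •
      f (insertAt id k l N 0 g fun j => y (extendPerm 0 (by omega) τ j)) =
      f (insertAt id k l N 0 g' y) := by
  rw [insertAt_zero_comp_inner h, insertAt_congr (g' := fun v =>
    koszulSign (extendPerm (n := N + 1) 0 (by omega) τ) q • g' v)]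
  · have := map_insertAt_smul f id l N 0 (koszulSign (extendPerm (n := N + 1) 0 (by omega) τ) q) g' y
    rw [Fin.val_zero] at this
    rw [this, koszulSign_smul_smul]
  · rw [hτ (fun r => q (Fin.ofNat (N + 1) (0 + r.val))) _ fun r => hy _, koszulSign_extendPerm]
    congr 2
    funext r
    congr 1
    rw [ofNat_eq_iff (by omega)]

theorem map_insertAt_outer {k l N : ℕ} (h : k + l = N) {n : ZMod 2}
    (f : MultilinearMap K (fun _ : Fin (k + 1) => V) W)
    {g : MultilinearMap K (fun _ : Fin (l + 1) => V) V} (hg : HasParity 𝒱 𝒱 n g)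
    (e : Equiv.Perm (Fin k))
    (he : ∀ (p : Fin (k + 1) → ZMod 2) v, (∀ i, parityPart 𝒱 (p i) (v i) = v i) →
      f (fun r => v (extendPerm 1 (by omega) e r)) = koszulSign (extendPerm 1 (by omega) e) p • f v)
    {q : Fin (N + 1) → ZMod 2} {y : Fin (N + 1) → V} (hy : ∀ i, parityPart 𝒱 (q i) (y i) = y i) :
    koszulSign (extendPerm (l + 1) (by omega) e) q •
      f (insertAt id k l N 0 g fun j => y (extendPerm (l + 1) (by omega) e j)) =
      f (insertAt id k l N 0 g y) := by
  rw [insertAt_zero_comp_outer h, he _ _ (insertAt_zero_parity 𝒱 k l N hg hy),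
    koszulSign_extendPerm_insertParity h, koszulSign_smul_smul]

/-- Invariance of `σ ↦ ε(σ) f(g(x_{σ(1)}, …), …)` under transpositions within the two blocks. -/
theorem koszulSign_smul_insertAt_mul_swap {k l N : ℕ} (h : k + l = N) {n : ZMod 2}
    (f : MultilinearMap K (fun _ : Fin (k + 1) => V) W)
    {g : MultilinearMap K (fun _ : Fin (l + 1) => V) V} (hg : HasParity 𝒱 𝒱 n g)
    (i j : Fin (N + 1))
    (hij : (∃ r s : Fin (l + 1), i.val = r.val ∧ j.val = s.val ∧
        ∀ (p : Fin (l + 1) → ZMod 2) v, (∀ i, parityPart 𝒱 (p i) (v i) = v i) →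
          g (fun a => v (Equiv.swap r s a)) = koszulSign (Equiv.swap r s) p • g v) ∨
      ∃ r s : Fin (k + 1), 0 < r.val ∧ 0 < s.val ∧ i.val = r.val + l ∧ j.val = s.val + l ∧
        ∀ (p : Fin (k + 1) → ZMod 2) v, (∀ i, parityPart 𝒱 (p i) (v i) = v i) →
          f (fun a => v (Equiv.swap r s a)) = koszulSign (Equiv.swap r s) p • f v)
    {q : Fin (N + 1) → ZMod 2} {z : Fin (N + 1) → V} (hz : ∀ i, parityPart 𝒱 (q i) (z i) = z i)
    (σ : Equiv.Perm (Fin (N + 1))) :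
    koszulSign (σ * Equiv.swap i j) q • f (insertAt id k l N 0 g fun a => z ((σ * Equiv.swap i j) a)) =
      koszulSign σ q • f (insertAt id k l N 0 g fun a => z (σ a)) := by
  rw [koszulSign_mul, mul_smul]
  congr 1
  rcases hij with ⟨r, s, hr, hs, hgs⟩ | ⟨r, s, hr0, hs0, hr, hs, hfs⟩
  · rw [← extendPerm_swap 0 (show 0 + (l + 1) ≤ N + 1 by omega) r s i j (by omega) (by omega)]
    exact map_insertAt_inner 𝒱 h f g g _ hgs fun a => hz (σ a)
  · have e1 := extendPerm_swap 1 (show 1 + k ≤ k + 1 by omega) ⟨r.val - 1, by omega⟩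
      ⟨s.val - 1, by omega⟩ r s (by simp only; omega) (by simp only; omega)
    rw [← extendPerm_swap (l + 1) (show l + 1 + k ≤ N + 1 by omega) ⟨r.val - 1, by omega⟩
      ⟨s.val - 1, by omega⟩ i j (by simp only; omega) (by simp only; omega)]
    refine map_insertAt_outer 𝒱 h f hg _ ?_ fun a => hz (σ a)
    rw [e1]
    exact hfs

-- The summand is invariant under permutations within the arguments of `g` and within the remaining
-- arguments of `f`, so each shuffle stands for a full coset of `S_{l+1} × S_k`.
open Classical in
theorem sum_perm_eq_sum_isShuffle {k l N : ℕ} (h : k + l = N) {n : ZMod 2}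
    {f : MultilinearMap K (fun _ : Fin (k + 1) => V) W} (hf : IsParitySymm 𝒱 f)
    {g : MultilinearMap K (fun _ : Fin (l + 1) => V) V} (hg : HasParity 𝒱 𝒱 n g)
    (hgs : IsParitySymm 𝒱 g)
    {q : Fin (N + 1) → ZMod 2} {z : Fin (N + 1) → V} (hz : ∀ i, parityPart 𝒱 (q i) (z i) = z i) :
    ∑ σ : Equiv.Perm (Fin (N + 1)), koszulSign σ q • f (insertAt id k l N 0 g fun j => z (σ j)) =
      ((l + 1).factorial * k.factorial) • ∑ σ : Equiv.Perm (Fin (N + 1)), koszulSign σ q •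
        if IsShuffle (l + 1) σ then f (insertAt id k l N 0 g fun j => z (σ j)) else 0 := by
  let b : Fin (N + 1) → Fin 2 := fun a => if a.val < l + 1 then 0 else 1
  have hb : Monotone b := by
    intro i j hij
    have : i.val ≤ j.val := hij
    simp only [b]
    split_ifs
    all_goals omega
  have hbv : ∀ i j, b i = b j ↔ (i.val < l + 1 ↔ j.val < l + 1) := by
    intro i j
    simp only [b]
    split_ifs <;> simp [*]
  rw [sum_perm_eq_smul_sum_shuffles hb]
  · have c0 : Fintype.card {a // b a = 0} = l + 1 := by
      rw [← Nat.sub_zero (l + 1), ← card_interval (n := N + 1) (s := 0) (t := l + 1) (by omega)]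
      refine Fintype.card_congr (Equiv.subtypeEquivRight fun a => ?_)
      simp only [b]
      split_ifs <;> simp <;> omega
    have c1 : Fintype.card {a // b a = 1} = k := by
      have : k = (N + 1) - (l + 1) := by omega
      rw [this, ← card_interval (n := N + 1) (s := l + 1) (t := N + 1) le_rfl]
      refine Fintype.card_congr (Equiv.subtypeEquivRight fun a => ?_)
      simp only [b]
      split_ifs <;> simp <;> omega
    rw [Fin.prod_univ_two, c0, c1]
    congr 1
    refine Finset.sum_congr rfl fun σ _ => ?_
    have : IncreasingOnBlocks b σ ↔ IsShuffle (l + 1) σ := by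
      refine forall₃_congr fun i j hij => imp_congr_left ?_
      have : i.val < j.val := hij
      rw [hbv]
      omega
    simp only [this, smul_ite, smul_zero]
  · intro σ i j hij hbij
    refine koszulSign_smul_insertAt_mul_swap 𝒱 h f hg i j ?_ hz σ
    rw [hbv] at hbij
    by_cases hi : i.val < l + 1
    · left
      exact ⟨⟨i.val, hi⟩, ⟨j.val, hbij.mp hi⟩, rfl, rfl, fun p v hv => hgs _ p v hv⟩
    · right
      refine ⟨⟨i.val - l, by omega⟩, ⟨j.val - l, by omega⟩, ?_, ?_, ?_, ?_, fun p v hv => hf _ p v hv⟩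
        <;> simp only <;> omega

theorem nsmul_left_cancel [CharZero K] {m : ℕ} (hm : m ≠ 0) {a b : W} (h : m • a = m • b) : a = b := by
  rw [← Nat.cast_smul_eq_nsmul K, ← Nat.cast_smul_eq_nsmul K] at h
  exact smul_right_injective W (Nat.cast_ne_zero.mpr hm) h

/-- Symmetrization intertwines the circle products on `Hom(T̄ V, V)` and `Hom(S̄ V, V)`. -/
theorem symmCirc_symmetrize [CharZero K] {n : ℤ} (F G : Ops K V V)
    (hG : ∀ l, HasParity 𝒱 𝒱 (n : ZMod 2) (G l)) (N : ℕ) (x : Fin (N + 1) → V) :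
    symmCirc 𝒱 (fun k => symmetrize 𝒱 F k) (fun k => symmetrize 𝒱 G k) N x =
      koszulSum 𝒱 (fun _ y => circ 𝒱 n (fun k => F k) (fun k => G k) N y) x := by
  unfold symmCirc koszulSum circ
  rw [Finset.sum_comm]
  refine Finset.sum_congr rfl fun p _ => ?_
  simp only [Finset.smul_sum]
  rw [Finset.sum_comm' (t' := Finset.HasAntidiagonal.antidiagonal N) (s' := fun _ => Finset.univ)
    (by simp)]
  refine Finset.sum_congr rfl fun kl hkl => ?_
  have h : kl.1 + kl.2 = N := Finset.HasAntidiagonal.mem_antidiagonal.mp hkl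
  simp only [← Finset.smul_sum]
  -- This multiple replaces shuffles by all permutations, where the two sides can be compared.
  refine nsmul_left_cancel (K := K) (m := (kl.2 + 1).factorial * kl.1.factorial)
    (Nat.mul_ne_zero (Nat.factorial_ne_zero _) (Nat.factorial_ne_zero _)) ?_
  have hz : ∀ i, parityPart 𝒱 (p i) (parityPart 𝒱 (p i) (x i)) = parityPart 𝒱 (p i) (x i) :=
    fun i => by rw [parityPart_parityPart, if_pos rfl]
  rw [← sum_symmetrize_insertAt 𝒱 h F G (hG kl.2) hz,
    sum_perm_eq_sum_isShuffle 𝒱 h (symmetrize_isParitySymm 𝒱 F kl.1) (HasParity.symmetrize hG kl.2)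
      (symmetrize_isParitySymm 𝒱 G kl.2) hz]

end Symmetrization

/-! ### Formal properties of graded sums. -/

section KoszulSum

variable {K : Type*} [Field K] {V : Type*} [AddCommGroup V] [Module K V]
  (𝒱 : ℤ → Submodule K V) [DirectSum.Decomposition 𝒱]

theorem map_koszulSum {W W' : Type*} [AddCommGroup W] [AddCommGroup W'] {k : ℕ} (φ : W →+ W')
    (F : Equiv.Perm (Fin k) → (Fin k → V) → W) (x : Fin k → V) :
    φ (koszulSum 𝒱 F x) = koszulSum 𝒱 (fun σ y => φ (F σ y)) x := by
  simp only [koszulSum, map_sum, map_zsmul]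

theorem koszulSum_sub {W : Type*} [AddCommGroup W] {k : ℕ}
    (F G : Equiv.Perm (Fin k) → (Fin k → V) → W) (x : Fin k → V) :
    koszulSum 𝒱 F x - koszulSum 𝒱 G x = koszulSum 𝒱 (fun σ y => F σ y - G σ y) x := by
  simp only [koszulSum, ← Finset.sum_sub_distrib, smul_sub]

theorem koszulSum_eq_zero {W : Type*} [AddCommGroup W] {k : ℕ}
    {F : Equiv.Perm (Fin k) → (Fin k → V) → W} {x : Fin k → V}
    (h : ∀ σ (p : Fin k → ZMod 2), F σ (fun i => parityPart 𝒱 (p (σ i)) (x (σ i))) = 0) :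
    koszulSum 𝒱 F x = 0 :=
  Finset.sum_eq_zero fun p _ => Finset.sum_eq_zero fun σ _ => by rw [h, smul_zero]

theorem symmetrize_apply {W : Type*} [AddCommGroup W] [Module K W] (f : Ops K V W) (k : ℕ)
    (x : Fin (k + 1) → V) : symmetrize 𝒱 f k x = koszulSum 𝒱 (fun _ y => f k y) x := by
  rw [symmetrize, koszulSumMap_apply]

/-- In arity one there is only the trivial permutation, and the parity parts of the argument add up
to it again. -/
theorem symmetrize_zero_apply {W : Type*} [AddCommGroup W] [Module K W] (f : Ops K V W)
    (x : Fin (0 + 1) → V) : symmetrize 𝒱 f 0 x = f 0 x := by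
  rw [symmetrize_apply, koszulSum]
  have h1 : ∀ p : Fin (0 + 1) → ZMod 2, ∑ σ : Equiv.Perm (Fin (0 + 1)),
      koszulSign σ p • f 0 (fun i => parityPart 𝒱 (p (σ i)) (x (σ i))) =
      f 0 (fun i => parityPart 𝒱 (p i) (x i)) := by
    intro p
    have : Subsingleton (Equiv.Perm (Fin (0 + 1))) := inferInstanceAs (Subsingleton (Equiv.Perm (Fin 1)))
    rw [Fintype.sum_subsingleton _ 1, koszulSign_one, one_smul]
    rfl
  rw [Finset.sum_congr rfl fun p _ => h1 p, ← (f 0).map_sum (fun i q => parityPart 𝒱 q (x i))]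
  simp only [sum_parityPart]

end KoszulSum

/-! ### From `A_∞[1]` to `L_∞[1]`. -/

section LInf

variable {K : Type*} [Field K] [CharZero K] {V : Type*} [AddCommGroup V] [Module K V]
  {𝒱 : ℤ → Submodule K V} [DirectSum.Decomposition 𝒱]

theorem IsAInfAlgebra.symmetrize {μ : Ops K V V} (hμ : IsAInfAlgebra 𝒱 μ) :
    IsLInfAlgebra 𝒱 (symmetrize 𝒱 μ) where
  degree := HasDegree.symmetrize hμ.degree
  symm k := (symmetrize_isParitySymm 𝒱 μ k).isGradedSymm
  identity N x := by
    rw [symmCirc_symmetrize 𝒱 (n := 1) μ μ fun l => (hμ.degree l).hasParity]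
    exact koszulSum_eq_zero 𝒱 fun σ p => hμ.identity N _

end LInf

/-! ### Symmetrization of bimodules, through operations on `A ⊕ M`. -/

section Pairs

variable {K : Type*} [Field K] {A M : Type*} [AddCommGroup A] [Module K A]
  [AddCommGroup M] [Module K M]

/-- `liftOps`, with multilinear members. -/
def liftOpsMap (μ : Ops K A A) (η : Ops K (A × M) M) : Ops K (A × M) (A × M) :=
  fun k => ((μ k).compLinearMap (fun _ => LinearMap.fst K A M)).prod (η k)

theorem coe_liftOpsMap (μ : Ops K A A) (η : Ops K (A × M) M) :
    (fun k => ⇑(liftOpsMap μ η k)) = liftOps μ η := rfl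

/-- `liftMap`, with multilinear members. -/
def liftMapMap (T : Ops K M A) : Ops K (A × M) (A × M) :=
  fun k => (LinearMap.inl K A M).compMultilinearMap
    ((T k).compLinearMap (fun _ => LinearMap.snd K A M))

theorem coe_liftMapMap (T : Ops K M A) : (fun k => ⇑(liftMapMap T k)) = liftMap T := rfl

variable {𝒜 : ℤ → Submodule K A} {ℳ : ℤ → Submodule K M}

theorem HasDegree.liftOpsMap {μ : Ops K A A} {η : Ops K (A × M) M} {n : ℤ} {k : ℕ}
    (hμ : HasDegree 𝒜 𝒜 n (μ k)) (hη : HasDegree (prodGrading 𝒜 ℳ) ℳ n (η k)) :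
    HasDegree (prodGrading 𝒜 ℳ) (prodGrading 𝒜 ℳ) n (liftOpsMap μ η k) :=
  fun d x hx => ⟨hμ d _ fun i => (hx i).1, hη d x hx⟩

theorem HasDegree.liftMapMap {T : Ops K M A} {n : ℤ} {k : ℕ} (hT : HasDegree ℳ 𝒜 n (T k)) :
    HasDegree (prodGrading 𝒜 ℳ) (prodGrading 𝒜 ℳ) n (liftMapMap T k) :=
  fun d _ hx => ⟨hT d _ fun i => (hx i).2, (ℳ _).zero_mem⟩

variable [DirectSum.Decomposition 𝒜] [DirectSum.Decomposition ℳ]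

/-- Parity splitting is componentwise, hence so is symmetrization. Module statements thus follow
from statements about the single family `Δ` on `A ⊕ M`. -/
theorem symmetrize_liftOpsMap (μ : Ops K A A) (η : Ops K (A × M) M) :
    symmetrize (prodGrading 𝒜 ℳ) (liftOpsMap μ η) =
      liftOpsMap (symmetrize 𝒜 μ) (symmetrize (prodGrading 𝒜 ℳ) η) := by
  funext k
  ext1 x
  rw [symmetrize_apply]
  refine Prod.ext ?_ ?_
  · refine (map_koszulSum _ (AddMonoidHom.fst A M) _ x).trans ?_
    change _ = symmetrize 𝒜 μ k _
    rw [symmetrize_apply]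
    simp only [koszulSum, parityPart_prod]
    rfl
  · refine (map_koszulSum _ (AddMonoidHom.snd A M) _ x).trans ?_
    exact (symmetrize_apply _ η k x).symm

theorem IsLinearInM.symmetrize {η : Ops K (A × M) M} (hη : IsLinearInM η) :
    IsLinearInM (symmetrize (prodGrading 𝒜 ℳ) η) := by
  intro k S x h1 h2 hS
  rw [symmetrize_apply]
  refine koszulSum_eq_zero _ fun σ p => hη k (S.map σ⁻¹.toEmbedding) _ ?_ ?_ (by simpa using hS)
  · intro i hi
    rw [parityPart_prod]
    have : σ i ∈ S := by
      obtain ⟨j, hj, rfl⟩ := Finset.mem_map.mp hi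
      simpa using hj
    simp [h1 _ this]
  · intro i hi
    rw [parityPart_prod]
    have : σ i ∉ S := by
      intro h
      exact hi (Finset.mem_map.mpr ⟨σ i, h, by simp⟩)
    simp [h2 _ this]

theorem IsAInfBimodule.symmetrize [CharZero K] {μ : Ops K A A} {η : Ops K (A × M) M}
    (hμ : IsAInfAlgebra 𝒜 μ) (hη : IsAInfBimodule 𝒜 ℳ μ η) :
    IsLInfModule 𝒜 ℳ (symmetrize 𝒜 μ) (symmetrize (prodGrading 𝒜 ℳ) η) where
  degree := HasDegree.symmetrize hη.degree
  symm k := (symmetrize_isParitySymm _ η k).isGradedSymm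
  linearInM := hη.linearInM.symmetrize
  identity N x hx := by
    rw [← coe_liftOpsMap, ← symmetrize_liftOpsMap, symmCirc_symmetrize (prodGrading 𝒜 ℳ) (n := 1)
      (liftOpsMap μ η) (liftOpsMap μ η) fun l => ((hμ.degree l).liftOpsMap (hη.degree l)).hasParity]
    refine koszulSum_eq_zero _ fun σ p => hη.identity N _ ?_
    obtain ⟨r, hr, h⟩ := hx
    -- Permuting by `σ` carries the entry from `M` to position `σ⁻¹ r`.
    refine ⟨σ⁻¹ r, ?_, fun i hi => ?_⟩
    · dsimp only
      rw [parityPart_prod]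
      simp [hr]
    · dsimp only
      rw [parityPart_prod, h (σ i) fun h' => hi (by simp [← h'])]
      simp

end Pairs

/-! ### Iterated brackets with a strict operator. -/

section DerivedBracket

variable {K : Type*} [Field K] {A M : Type*} [AddCommGroup A] [Module K A]
  [AddCommGroup M] [Module K M] (T : M →ₗ[K] A)

/-- The endomorphism `(a, m) ↦ (T m, 0)`. -/
def prodEnd : A × M →ₗ[K] A × M := LinearMap.inl K A M ∘ₗ T ∘ₗ LinearMap.snd K A M

theorem prodEnd_apply (x : A × M) : prodEnd T x = (T x.2, 0) := rfl

theorem prodEnd_prodEnd (x : A × M) : prodEnd T (prodEnd T x) = 0 := by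
  simp [prodEnd_apply]

/-- The bracket with a strict operator `T`, on families of multilinear maps. -/
def strictBracket (F : Ops K (A × M) (A × M)) : Ops K (A × M) (A × M) := fun k =>
  (∑ i : Fin (k + 1), (F k).compLinearMap (fun j => if j = i then prodEnd T else LinearMap.id)) -
    (prodEnd T).compMultilinearMap (F k)

/-- Application of `(a, m) ↦ (T m, 0)` to the entries with index in `S`. -/
def applyOn {k : ℕ} (S : Finset (Fin k)) (x : Fin k → A × M) : Fin k → A × M :=
  fun j => if j ∈ S then prodEnd T (x j) else x j

theorem strictBracket_apply (F : Ops K (A × M) (A × M)) (k : ℕ) (x : Fin (k + 1) → A × M) :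
    strictBracket T F k x = ∑ i, F k (applyOn T {i} x) - prodEnd T (F k x) := by
  simp only [strictBracket, sub_apply, sum_apply,
    LinearMap.compMultilinearMap_apply]
  congr 1
  refine Finset.sum_congr rfl fun i _ => ?_
  rw [MultilinearMap.compLinearMap_apply]
  congr 1
  funext j
  simp only [applyOn, Finset.mem_singleton]
  split_ifs <;> rfl

/-- Double counting: each set with `m + 1` elements arises by insertion once for each of its
elements. -/
theorem sum_insert_powersetCard {m : ℕ} {W : Type*} [AddCommMonoid W] {k : ℕ}
    (h : Finset (Fin k) → W) :
    ∑ i, ∑ S ∈ Finset.univ.powersetCard m, (if i ∈ S then 0 else h (insert i S)) =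
      (m + 1) • ∑ S ∈ Finset.univ.powersetCard (m + 1), h S := by
  have h1 : (m + 1) • ∑ S ∈ Finset.univ.powersetCard (m + 1), h S =
      ∑ S ∈ Finset.univ.powersetCard (m + 1), ∑ i, if i ∈ S then h S else 0 := by
    rw [Finset.smul_sum]
    refine Finset.sum_congr rfl fun S hS => ?_
    rw [Finset.sum_ite_mem, Finset.univ_inter, Finset.sum_const, (Finset.mem_powersetCard.mp hS).2]
  rw [h1, Finset.sum_comm' (t' := Finset.univ) (s' := fun _ => Finset.univ.powersetCard (m + 1))
    (by simp)]
  refine Finset.sum_congr rfl fun i _ => ?_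
  rw [← Finset.sum_filter]
  simp only [← ite_not (i ∈ _)]
  rw [← Finset.sum_filter]
  refine Finset.sum_bij' (fun S _ => insert i S) (fun S _ => S.erase i) ?_ ?_ ?_ ?_ ?_
  · intro S hS
    simp only [Finset.mem_filter, Finset.mem_powersetCard_univ] at hS ⊢
    exact ⟨by rw [Finset.card_insert_of_notMem hS.2, hS.1], Finset.mem_insert_self i S⟩
  · intro S hS
    simp only [Finset.mem_filter, Finset.mem_powersetCard_univ] at hS ⊢
    exact ⟨by rw [Finset.card_erase_of_mem hS.2, hS.1]; rfl, Finset.notMem_erase i S⟩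
  · intro S hS
    exact Finset.erase_insert (Finset.mem_filter.mp hS).2
  · intro S hS
    exact Finset.insert_erase (Finset.mem_filter.mp hS).2
  · intro S _
    rfl

theorem sum_applyOn_singleton {W : Type*} [AddCommGroup W] [Module K W] {k m : ℕ}
    (f : MultilinearMap K (fun _ : Fin k => A × M) W) (x : Fin k → A × M) :
    ∑ i, ∑ S ∈ Finset.univ.powersetCard m, f (applyOn T S (applyOn T {i} x)) =
      (m + 1) • ∑ S ∈ Finset.univ.powersetCard (m + 1), f (applyOn T S x) := by
  rw [← sum_insert_powersetCard]
  refine Finset.sum_congr rfl fun i _ => Finset.sum_congr rfl fun S _ => ?_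
  split_ifs with hi
  · refine f.map_coord_zero i ?_
    simp [applyOn, hi, prodEnd_prodEnd]
  · congr 1
    funext j
    simp only [applyOn, Finset.mem_insert, Finset.mem_singleton]
    by_cases h1 : j = i
    · subst h1; simp [hi]
    · simp [h1]

/-- Let `X` be the sum of the commuting square-zero operators applying `E` to one entry, and `L` the
application of `E` to the output. Then `X^m = m! e_m`, with `e_m` the sum over `m`-element sets of
entries, and `L² = 0`, so `(X - L)^{n+1} = X^{n+1} - (n+1) L X^n`. -/
theorem iterate_strictBracket_apply (F : Ops K (A × M) (A × M)) (n k : ℕ)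
    (x : Fin (k + 1) → A × M) :
    (strictBracket T)^[n + 1] F k x = (n + 1).factorial •
      (∑ S ∈ Finset.univ.powersetCard (n + 1), F k (applyOn T S x) -
        prodEnd T (∑ S ∈ Finset.univ.powersetCard n, F k (applyOn T S x))) := by
  induction n generalizing x with
  | zero =>
    have e0 : applyOn T ∅ x = x := by funext j; simp [applyOn]
    simp only [zero_add, Function.iterate_one, strictBracket_apply, Nat.factorial_one, one_smul,
      Finset.powersetCard_zero, Finset.sum_singleton, Finset.powersetCard_one, Finset.sum_map, e0]
    rfl
  | succ n ih =>
    rw [Function.iterate_succ_apply', strictBracket_apply]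
    simp only [ih]
    rw [← Finset.smul_sum, map_nsmul, ← smul_sub, map_sub, prodEnd_prodEnd, sub_zero,
      Finset.sum_sub_distrib, ← map_sum, sum_applyOn_singleton, sum_applyOn_singleton,
      map_nsmul, Nat.factorial_succ (n + 1), mul_comm, mul_smul]
    congr 1
    -- The `n + 1` copies of the correction term created by applying `E` to entries and the one
    -- created by applying it to the output make `n + 2`.
    rw [smul_sub, sub_sub, ← succ_nsmul]

variable (𝒜 : ℤ → Submodule K A) [DirectSum.Decomposition 𝒜]
  (ℳ : ℤ → Submodule K M) [DirectSum.Decomposition ℳ]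

theorem liftMap_strictFamily_succ (k : ℕ) (x : Fin (k + 1 + 1) → A × M) :
    liftMap (strictFamily T) (k + 1) x = 0 := rfl

theorem liftMap_strictFamily_zero (x : Fin (0 + 1) → A × M) :
    liftMap (strictFamily T) 0 x = prodEnd T (x 0) := rfl

theorem circ_strict_right (F : Ops K (A × M) (A × M)) (N : ℕ) (x : Fin (N + 1) → A × M) :
    circ (prodGrading 𝒜 ℳ) 0 (fun k => F k) (liftMap (strictFamily T)) N x =
      ∑ i, F N (applyOn T {i} x) := by
  unfold circ
  rw [Finset.sum_eq_single (N, 0)]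
  · refine Finset.sum_congr rfl fun i _ => ?_
    congr 1
    funext j
    simp only [insertAt, applyOn, Finset.mem_singleton, sgn_zero, liftMap_strictFamily_zero, Fin.ext_iff]
    by_cases h : j.val = i.val
    · rw [if_neg (by omega), if_pos h, if_pos h, ← h]
      simp
    · rw [if_neg h, if_neg h]
      simp
  · rintro ⟨k, l⟩ h hne
    have h' : k + l = N := Finset.HasAntidiagonal.mem_antidiagonal.mp h
    obtain ⟨l, rfl⟩ : ∃ l', l = l' + 1 := by
      cases l with
      | zero => exact absurd (by simpa using h') hne
      | succ l => exact ⟨l, rfl⟩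
    refine Finset.sum_eq_zero fun i _ => (F k).map_coord_zero i ?_
    simp [insertAt, liftMap_strictFamily_succ]
  · intro h
    exact absurd (Finset.HasAntidiagonal.mem_antidiagonal.mpr (by simp)) h

theorem circ_strict_left (F : Fam (A × M)) (N : ℕ) (x : Fin (N + 1) → A × M) :
    circ (prodGrading 𝒜 ℳ) 1 (liftMap (strictFamily T)) F N x = prodEnd T (F N x) := by
  unfold circ
  rw [Finset.sum_eq_single (0, N)]
  · simp only [Nat.reduceAdd, Finset.univ_unique, Fin.default_eq_zero, Finset.sum_singleton]
    rw [liftMap_strictFamily_zero]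
    simp only [insertAt]
    simp
  · rintro ⟨k, l⟩ h hne
    have h' : k + l = N := Finset.HasAntidiagonal.mem_antidiagonal.mp h
    cases k with
    | zero => exact absurd (by simpa using h') hne
    | succ k => exact Finset.sum_eq_zero fun i _ => liftMap_strictFamily_succ T k _
  · intro h
    exact absurd (Finset.HasAntidiagonal.mem_antidiagonal.mpr (by simp)) h

theorem bracket_strict (F : Ops K (A × M) (A × M)) :
    bracket (prodGrading 𝒜 ℳ) 1 0 (fun k => F k) (liftMap (strictFamily T)) =
      fun k => ⇑(strictBracket T F k) := by
  funext N x
  rw [strictBracket_apply, bracket, circ_strict_right, circ_strict_left]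
  simp

theorem iterate_bracket_strict (F : Ops K (A × M) (A × M)) (n : ℕ) :
    (fun F => bracket (prodGrading 𝒜 ℳ) 1 0 F (liftMap (strictFamily T)))^[n] (fun k => ⇑(F k)) =
      fun k => ⇑((strictBracket T)^[n] F k) := by
  induction n with
  | zero => rfl
  | succ n ih => rw [Function.iterate_succ_apply', ih, bracket_strict, Function.iterate_succ_apply']

/-- A strict operator lives in arity one, so it is its own symmetrization. Hence
`symmCirc_symmetrize` also covers circle products with `T`. -/
theorem symmetrize_liftMapMap_strictFamily :
    (fun k => ⇑(symmetrize (prodGrading 𝒜 ℳ) (liftMapMap (strictFamily T)) k)) =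
      liftMap (strictFamily T) := by
  funext k x
  cases k with
  | zero => exact symmetrize_zero_apply _ _ x
  | succ k =>
    rw [symmetrize_apply]
    exact koszulSum_eq_zero _ fun σ p => liftMap_strictFamily_succ T k
      (fun i => parityPart (prodGrading 𝒜 ℳ) (p (σ i)) (x (σ i)))

variable {T 𝒜 ℳ}

theorem strictBracket_hasParity (hT : ∀ i m, m ∈ ℳ i → T m ∈ 𝒜 i) {n : ZMod 2}
    {F : Ops K (A × M) (A × M)} (hF : ∀ k, HasParity (prodGrading 𝒜 ℳ) (prodGrading 𝒜 ℳ) n (F k))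
    (k : ℕ) : HasParity (prodGrading 𝒜 ℳ) (prodGrading 𝒜 ℳ) n (strictBracket T F k) := by
  have hE : ∀ p v, parityPart (prodGrading 𝒜 ℳ) p (prodEnd T v) =
      prodEnd T (parityPart (prodGrading 𝒜 ℳ) p v) := by
    intro p v
    exact parityPart_map (𝒱 := prodGrading 𝒜 ℳ) (𝒲 := prodGrading 𝒜 ℳ) (prodEnd T)
      (fun i v hv => ⟨hT i _ hv.2, (ℳ i).zero_mem⟩) p v
  intro q y hy
  rw [strictBracket_apply, map_sub, map_sum, hE, hF k q y hy]
  congr 1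
  refine Finset.sum_congr rfl fun i _ => hF k q _ fun j => ?_
  simp only [applyOn]
  split_ifs
  · rw [hE, hy]
  · exact hy j

theorem symmBracket_strict [CharZero K] (hT : ∀ k, HasDegree ℳ 𝒜 0 (strictFamily T k))
    {F : Ops K (A × M) (A × M)} (hF : ∀ k, HasParity (prodGrading 𝒜 ℳ) (prodGrading 𝒜 ℳ) 1 (F k)) :
    symmBracket (prodGrading 𝒜 ℳ) 1 0 (fun k => symmetrize (prodGrading 𝒜 ℳ) F k)
      (liftMap (strictFamily T)) =
      fun k => ⇑(symmetrize (prodGrading 𝒜 ℳ) (strictBracket T F) k) := by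
  funext N x
  rw [← symmetrize_liftMapMap_strictFamily T 𝒜 ℳ, symmBracket,
    symmCirc_symmetrize _ (n := 0) F _ fun l => (hT l).liftMapMap.hasParity,
    symmCirc_symmetrize _ (n := 1) _ F fun l => by simpa using hF l]
  simp only [mul_zero, Int.negOnePow_zero, Units.val_one, one_smul]
  rw [koszulSum_sub, symmetrize_apply]
  congr 1
  funext σ y
  rw [coe_liftMapMap, circ_strict_right, circ_strict_left, strictBracket_apply]

theorem iterate_symmBracket_strict [CharZero K] (hT : ∀ k, HasDegree ℳ 𝒜 0 (strictFamily T k))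
    {F : Ops K (A × M) (A × M)} (hF : ∀ k, HasParity (prodGrading 𝒜 ℳ) (prodGrading 𝒜 ℳ) 1 (F k))
    (n : ℕ) :
    (fun F => symmBracket (prodGrading 𝒜 ℳ) 1 0 F (liftMap (strictFamily T)))^[n]
      (fun k => ⇑(symmetrize (prodGrading 𝒜 ℳ) F k)) =
      fun k => ⇑(symmetrize (prodGrading 𝒜 ℳ) ((strictBracket T)^[n] F) k) := by
  have hT' : ∀ i m, m ∈ ℳ i → T m ∈ 𝒜 i := by
    intro i m hm
    simpa [strictFamily] using hT 0 (fun _ => i) (fun _ => m) fun _ => hm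
  -- Every partial bracket must have odd parity for `symmBracket_strict` to apply at the next stage.
  have hp : ∀ n k, HasParity (prodGrading 𝒜 ℳ) (prodGrading 𝒜 ℳ) 1 ((strictBracket T)^[n] F k) := by
    intro n
    induction n with
    | zero => exact hF
    | succ n ih => rw [Function.iterate_succ_apply']; exact strictBracket_hasParity hT' ih
  induction n with
  | zero => rfl
  | succ n ih =>
    rw [Function.iterate_succ_apply', ih, symmBracket_strict hT (hp n), Function.iterate_succ_apply']

end DerivedBracket

/-! ### Maurer-Cartan equations and the Rota-Baxter identity. -/

section StrictOperators

variable {K : Type*} [Field K] {A M : Type*} [AddCommGroup A] [Module K A]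
  [AddCommGroup M] [Module K M]

/-- The arguments `(T u_1, …, u_r, …, T u_k)`. -/
def mark (T : M →ₗ[K] A) {k : ℕ} (r : Fin k) (u : Fin k → M) : Fin k → A × M :=
  fun i => if i = r then (0, u i) else (T (u i), 0)

theorem mark_of_eq (T : M →ₗ[K] A) {k : ℕ} {r i : Fin k} (h : i = r) (u : Fin k → M) :
    mark T r u i = (0, u i) := if_pos h

theorem mark_self (T : M →ₗ[K] A) {k : ℕ} (r : Fin k) (u : Fin k → M) : mark T r u r = (0, u r) :=
  if_pos rfl

theorem mark_of_ne (T : M →ₗ[K] A) {k : ℕ} {r i : Fin k} (h : i ≠ r) (u : Fin k → M) :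
    mark T r u i = (T (u i), 0) := if_neg h

theorem mark_oneFromM (T : M →ₗ[K] A) {k : ℕ} (r : Fin k) (u : Fin k → M) :
    OneFromM (mark T r u) :=
  ⟨r, by rw [mark_self], fun i hi => by rw [mark_of_ne T hi]⟩

theorem mark_comp_perm (T : M →ₗ[K] A) {k : ℕ} (r : Fin k) (u : Fin k → M) (σ : Equiv.Perm (Fin k)) :
    (fun i => mark T (σ r) u (σ i)) = mark T r fun i => u (σ i) := by
  funext i
  simp only [mark, EmbeddingLike.apply_eq_iff_eq]

theorem dendOfRRB_apply (η : Ops K (A × M) M) (T : M →ₗ[K] A) (k : ℕ) (r : Fin (k + 1))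
    (u : Fin (k + 1) → M) : dendOfRRB η T k r u = η k (mark T r u) := by
  rw [dendOfRRB, MultilinearMap.compLinearMap_apply]
  congr 1
  funext i
  simp only [mark]
  split_ifs <;> rfl

theorem preLieOfRRBLie_eq (ρ : Ops K (A × M) M) (T : M →ₗ[K] A) (k : ℕ) :
    preLieOfRRBLie ρ T k = dendOfRRB ρ T k (Fin.last k) := rfl

/-- The Rota-Baxter identities `μ_k(T u_1, …, T u_k) = ∑_r T η_k(T u_1, …, u_r, …, T u_k)`. -/
def RotaBaxterIdentity (μ : Ops K A A) (η : Ops K (A × M) M) (T : M →ₗ[K] A) : Prop :=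
  ∀ (k : ℕ) (u : Fin (k + 1) → M), μ k (fun i => T (u i)) = T (∑ r, dendOfRRB η T k r u)

variable {μ : Ops K A A} {η : Ops K (A × M) M} {T : M →ₗ[K] A}

/-- An entry outside `S` keeps its zero component in `A` and kills `μ`; only the full set survives.
-/
theorem sum_applyOn_fst (μ : Ops K A A) (η : Ops K (A × M) M) (T : M →ₗ[K] A) (m N : ℕ)
    (u : Fin (N + 1) → M) :
    (∑ S ∈ Finset.univ.powersetCard m, liftOpsMap μ η N (applyOn T S fun i => (0, u i))).1 =
      if m = N + 1 then μ N (fun i => T (u i)) else 0 := by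
  rw [Prod.fst_sum]
  split_ifs with h
  · have : Finset.powersetCard m (Finset.univ : Finset (Fin (N + 1))) = {Finset.univ} := by
      rw [h]
      convert Finset.powersetCard_self (Finset.univ : Finset (Fin (N + 1)))
      simp
    rw [this, Finset.sum_singleton]
    change μ N _ = _
    congr 1
    funext i
    simp [applyOn, prodEnd_apply]
  · refine Finset.sum_eq_zero fun S hS => ?_
    have hS' : S ≠ Finset.univ := by
      rintro rfl
      rw [Finset.mem_powersetCard] at hS
      simp at hS
      omega
    obtain ⟨i, hi⟩ : ∃ i, i ∉ S := by
      by_contra! hc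
      exact hS' (Finset.eq_univ_iff_forall.mpr hc)
    refine (μ N).map_coord_zero i ?_
    simp [applyOn, hi]

/-- Entries outside `S` stay in `M`, so only complements of singletons contribute to `η`. -/
theorem sum_applyOn_snd (μ : Ops K A A) (hη : IsLinearInM η) (T : M →ₗ[K] A) (m N : ℕ)
    (u : Fin (N + 1) → M) :
    (∑ S ∈ Finset.univ.powersetCard m, liftOpsMap μ η N (applyOn T S fun i => (0, u i))).2 =
      if m = N then ∑ r, dendOfRRB η T N r u else 0 := by
  rw [Prod.snd_sum]
  split_ifs with h
  · subst h
    symm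
    refine Finset.sum_bij (fun r _ => {r}ᶜ) ?_ ?_ ?_ ?_
    · intro r _
      rw [Finset.mem_powersetCard_univ, Finset.card_compl]
      simp
    · intro r _ s _ hrs
      simpa using hrs
    · intro S hS
      rw [Finset.mem_powersetCard_univ] at hS
      have hc : Sᶜ.card = 1 := by rw [Finset.card_compl, hS]; simp
      obtain ⟨r, hr⟩ := Finset.card_eq_one.mp hc
      exact ⟨r, Finset.mem_univ r, by rw [← hr, compl_compl]⟩
    · intro r _
      rw [dendOfRRB_apply]
      change _ = η m _
      congr 1
      funext i
      simp only [mark, applyOn, Finset.mem_compl, Finset.mem_singleton, prodEnd_apply]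
      split_ifs <;> simp_all
  · refine Finset.sum_eq_zero fun S hS => ?_
    rw [Finset.mem_powersetCard_univ] at hS
    refine hη N Sᶜ _ ?_ ?_ ?_
    · intro i hi
      simp [applyOn, Finset.mem_compl.mp hi]
    · intro i hi
      rw [Finset.mem_compl, not_not] at hi
      simp [applyOn, hi, prodEnd_apply]
    · rw [Finset.card_compl, hS, Fintype.card_fin]
      omega

theorem iterate_strictBracket_liftOpsMap (μ : Ops K A A) (hη : IsLinearInM η) (T : M →ₗ[K] A)
    (n N : ℕ) (u : Fin (N + 1) → M) :
    ((strictBracket T)^[n + 1] (liftOpsMap μ η) N fun i => (0, u i)).1 =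
      if n = N then (N + 1).factorial • (μ N (fun i => T (u i)) - T (∑ r, dendOfRRB η T N r u))
      else 0 := by
  rw [iterate_strictBracket_apply, Prod.smul_fst, Prod.fst_sub, sum_applyOn_fst, prodEnd_apply,
    sum_applyOn_snd μ hη]
  by_cases h : n = N
  · subst h
    simp
  · simp [h]

variable {𝒜 : ℤ → Submodule K A} [DirectSum.Decomposition 𝒜]
  {ℳ : ℤ → Submodule K M} [DirectSum.Decomposition ℳ]

theorem IsStrictHomotopyRRB.mem (hT : IsStrictHomotopyRRB 𝒜 ℳ μ η T) (i : ℤ) (m : M)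
    (hm : m ∈ ℳ i) : T m ∈ 𝒜 i := by
  simpa [strictFamily] using hT.degree 0 (fun _ => i) (fun _ => m) fun _ => hm

theorem IsStrictHomotopyRRB.rotaBaxterIdentity [CharZero K] (hη : IsLinearInM η)
    (hT : IsStrictHomotopyRRB 𝒜 ℳ μ η T) : RotaBaxterIdentity μ η T := by
  intro N u
  have h := hT.maurerCartan N u
  have hd : ∀ n, derivedBracket 𝒜 ℳ μ η (strictFamily T) (n + 1) N u = if n = N then
      (N + 1).factorial • (μ N (fun i => T (u i)) - T (∑ r, dendOfRRB η T N r u)) else 0 := by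
    intro n
    rw [derivedBracket, ← coe_liftOpsMap, iterate_bracket_strict,
      ← iterate_strictBracket_liftOpsMap μ hη]
  -- Index `N` means `N + 1` copies of `T` in arity `N + 1`; the factorial of the iterated bracket
  -- cancels the Maurer-Cartan coefficient.
  rw [finsum_eq_single _ N fun n hn => by rw [hd, if_neg hn, smul_zero], hd, if_pos rfl,
    ← Nat.cast_smul_eq_nsmul K, smul_smul, inv_mul_cancel₀ (by exact_mod_cast Nat.factorial_ne_zero _),
    one_smul] at h
  exact sub_eq_zero.mp h

omit [DirectSum.Decomposition ℳ] in
theorem strictFamily_isGradedSymm (T : M →ₗ[K] A) (k : ℕ) : IsGradedSymm ℳ (strictFamily T k) := by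
  intro σ d x _
  cases k with
  | zero =>
    have : Subsingleton (Equiv.Perm (Fin (0 + 1))) := inferInstanceAs (Subsingleton (Equiv.Perm (Fin 1)))
    rw [Subsingleton.elim σ 1, koszulSign_one, one_smul]
    rfl
  | succ k =>
    change (0 : A) = _ • 0
    rw [smul_zero]

/-- Each symmetric derived bracket vanishes separately: it is a graded sum of ordinary derived
brackets, and every one of these is zero by the Rota-Baxter identity. -/
theorem RotaBaxterIdentity.symm_maurerCartan [CharZero K] (hμ : ∀ k, HasDegree 𝒜 𝒜 1 (μ k))
    (hd : ∀ k, HasDegree (prodGrading 𝒜 ℳ) ℳ 1 (η k)) (hη : IsLinearInM η)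
    (hT : ∀ k, HasDegree ℳ 𝒜 0 (strictFamily T k)) (h : RotaBaxterIdentity μ η T) :
    IsStrictHomotopyRRBLie 𝒜 ℳ (symmetrize 𝒜 μ) (symmetrize (prodGrading 𝒜 ℳ) η) T where
  degree := hT
  symm := strictFamily_isGradedSymm T
  maurerCartan N u := by
    have hz : ∀ n, symmDerivedBracket 𝒜 ℳ (symmetrize 𝒜 μ) (symmetrize (prodGrading 𝒜 ℳ) η)
        (strictFamily T) (n + 1) N u = 0 := by
      intro n
      rw [symmDerivedBracket, ← coe_liftOpsMap, ← symmetrize_liftOpsMap, iterate_symmBracket_strict hT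
        fun k => by simpa using ((hμ k).liftOpsMap (hd k)).hasParity]
      dsimp only
      rw [symmetrize_apply]
      refine (map_koszulSum _ (AddMonoidHom.fst A M) _ _).trans (koszulSum_eq_zero _ fun σ p => ?_)
      simp only [parityPart_prod, map_zero]
      refine (iterate_strictBracket_liftOpsMap μ hη T n N _).trans ?_
      rw [h, sub_self, smul_zero, ite_self]
    simp [hz]

end StrictOperators

/-! ### The dendriform structure, and the comparison of the two families `θ`. -/

section Dend

variable {K : Type*} [Field K] {A M : Type*} [AddCommGroup A] [Module K A]
  [AddCommGroup M] [Module K M]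
  {μ : Ops K A A} {η : Ops K (A × M) M} {T : M →ₗ[K] A}

theorem liftOps_eq_of_forall_fromA (hη : IsLinearInM η) (h : RotaBaxterIdentity μ η T) (l : ℕ)
    (u : Fin (l + 1) → M) :
    liftOps μ η l (fun i => (T (u i), 0)) = (T (∑ s, dendOfRRB η T l s u), 0) :=
  Prod.ext (h l u) (hη l ∅ _ (by simp) (by simp) (by simp))

theorem liftOps_mark (l : ℕ) (r : Fin (l + 1)) (u : Fin (l + 1) → M) :
    liftOps μ η l (mark T r u) = (0, dendOfRRB η T l r u) := by
  refine Prod.ext ((μ l).map_coord_zero r ?_) (dendOfRRB_apply η T l r u).symm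
  simp [mark]

/-- The inner operation sees only elements `T u`, and by the Rota-Baxter identity its value is again
`T` of something. The composed tuple is therefore again a marked one, with `r'` the position of `r`
after contracting the block. The maps `s`, `s'` stand for the sign operators or for identities. -/
theorem insertAt_mark_outside (hη : IsLinearInM η) (h : RotaBaxterIdentity μ η T)
    {s : A × M → A × M} {s' : M → M} (hs : ∀ m, s (0, m) = (0, s' m))
    (hs' : ∀ m, s (T m, 0) = (T (s' m), 0)) {k l N : ℕ} (hN : k + l = N) {i : ℕ} (hi : i ≤ k)
    (r : Fin (N + 1)) (r' : Fin (k + 1))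
    (hr : (r.val < i ∧ r'.val = r.val) ∨ (i + l < r.val ∧ r'.val + l = r.val)) (x : Fin (N + 1) → M) :
    insertAt s k l N i (liftOps μ η l) (mark T r x) =
      mark T r' (insertAt s' k l N i (fun z => ∑ t, dendOfRRB η T l t z) x) := by
  funext j
  by_cases h1 : j.val < i
  · have e1 : insertAt s k l N i (liftOps μ η l) (mark T r x) j =
        s (mark T r x (Fin.ofNat (N + 1) j.val)) := if_pos h1
    have e2 : insertAt s' k l N i (fun z => ∑ t, dendOfRRB η T l t z) x j =
        s' (x (Fin.ofNat (N + 1) j.val)) := if_pos h1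
    by_cases h2 : j.val = r.val
    · rw [e1, mark_of_eq T ((ofNat_eq_iff (by omega)).mpr h2), hs, mark_of_eq T (Fin.ext (by omega)), e2]
    · rw [e1, mark_of_ne T (mt (ofNat_eq_iff (by omega)).mp h2), hs',
        mark_of_ne T (mt Fin.ext_iff.mp (by omega)), e2]
  · by_cases h2 : j.val = i
    · have e1 : insertAt s k l N i (liftOps μ η l) (mark T r x) j =
          liftOps μ η l (fun a => mark T r x (Fin.ofNat (N + 1) (i + a.val))) :=
        (if_neg h1).trans (if_pos h2)
      have e2 : insertAt s' k l N i (fun z => ∑ t, dendOfRRB η T l t z) x j =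
          ∑ t, dendOfRRB η T l t (fun a => x (Fin.ofNat (N + 1) (i + a.val))) :=
        (if_neg h1).trans (if_pos h2)
      have e3 : (fun a : Fin (l + 1) => mark T r x (Fin.ofNat (N + 1) (i + a.val))) =
          fun a => (T (x (Fin.ofNat (N + 1) (i + a.val))), 0) := by
        funext a
        refine mark_of_ne T ?_ x
        rw [Ne, ofNat_eq_iff (by omega)]
        omega
      rw [e1, e3, liftOps_eq_of_forall_fromA hη h, mark_of_ne, e2]
      rw [Ne, Fin.ext_iff]
      omega
    · have e1 : insertAt s k l N i (liftOps μ η l) (mark T r x) j =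
          mark T r x (Fin.ofNat (N + 1) (j.val + l)) := (if_neg h1).trans (if_neg h2)
      have e2 : insertAt s' k l N i (fun z => ∑ t, dendOfRRB η T l t z) x j =
          x (Fin.ofNat (N + 1) (j.val + l)) := (if_neg h1).trans (if_neg h2)
      by_cases h3 : j.val = r'.val
      · rw [e1, mark_of_eq T ((ofNat_eq_iff (by omega)).mpr (by omega)), mark_of_eq T (Fin.ext h3), e2]
      · rw [e1, mark_of_ne T (mt (ofNat_eq_iff (by omega)).mp (by omega)),
          mark_of_ne T (mt Fin.ext_iff.mp h3), e2]

/-- The inner value lies in `M` and takes over the mark; the Rota-Baxter identity plays no role. -/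
theorem insertAt_mark_inside {s : A × M → A × M} {s' : M → M}
    (hs' : ∀ m, s (T m, 0) = (T (s' m), 0)) {k l N : ℕ} (hN : k + l = N) (i : Fin (k + 1))
    (r : Fin (N + 1)) (r' : Fin (l + 1)) (hr : i.val + r'.val = r.val) (x : Fin (N + 1) → M) :
    insertAt s k l N i (liftOps μ η l) (mark T r x) =
      mark T i (insertAt s' k l N i (dendOfRRB η T l r') x) := by
  funext j
  by_cases h1 : j.val < i.val
  · have e1 : insertAt s k l N i (liftOps μ η l) (mark T r x) j =
        s (mark T r x (Fin.ofNat (N + 1) j.val)) := if_pos h1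
    have e2 : insertAt s' k l N i (dendOfRRB η T l r') x j =
        s' (x (Fin.ofNat (N + 1) j.val)) := if_pos h1
    rw [e1, mark_of_ne, hs', mark_of_ne, e2]
    · rw [Ne, Fin.ext_iff]; omega
    · rw [Ne, ofNat_eq_iff (by omega)]; omega
  · by_cases h2 : j.val = i.val
    · have e1 : insertAt s k l N i (liftOps μ η l) (mark T r x) j =
          liftOps μ η l (fun a => mark T r x (Fin.ofNat (N + 1) (i + a.val))) :=
        (if_neg h1).trans (if_pos h2)
      have e2 : insertAt s' k l N i (dendOfRRB η T l r') x j =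
          dendOfRRB η T l r' (fun a => x (Fin.ofNat (N + 1) (i + a.val))) :=
        (if_neg h1).trans (if_pos h2)
      have e3 : (fun a : Fin (l + 1) => mark T r x (Fin.ofNat (N + 1) (i + a.val))) =
          mark T r' fun a => x (Fin.ofNat (N + 1) (i + a.val)) := by
        funext a
        simp only [mark, ofNat_eq_iff (show i.val + a.val ≤ N by omega), Fin.ext_iff, ← hr,
          Nat.add_left_cancel_iff]
      rw [e1, e3, liftOps_mark, mark_of_eq T (Fin.ext h2), e2]
    · have e1 : insertAt s k l N i (liftOps μ η l) (mark T r x) j =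
          mark T r x (Fin.ofNat (N + 1) (j.val + l)) := (if_neg h1).trans (if_neg h2)
      have e2 : insertAt s' k l N i (dendOfRRB η T l r') x j =
          x (Fin.ofNat (N + 1) (j.val + l)) := (if_neg h1).trans (if_neg h2)
      rw [e1, mark_of_ne, mark_of_ne, e2]
      · rw [Ne, Fin.ext_iff]; omega
      · rw [Ne, ofNat_eq_iff (by omega)]; omega

variable {𝒜 : ℤ → Submodule K A} [DirectSum.Decomposition 𝒜]
  {ℳ : ℤ → Submodule K M} [DirectSum.Decomposition ℳ]

theorem sgn_prodGrading_snd (n : ℤ) (m : M) :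
    sgn (prodGrading 𝒜 ℳ) n (0, m) = (0, sgn ℳ n m) := by
  rw [sgn_prod, map_zero]

theorem sgn_prodGrading_fst (hT : ∀ i m, m ∈ ℳ i → T m ∈ 𝒜 i) (n : ℤ) (m : M) :
    sgn (prodGrading 𝒜 ℳ) n (T m, 0) = (T (sgn ℳ n m), 0) := by
  rw [sgn_prod, map_zero, sgn_map T hT]

/-- The summands match one by one: the three cases of `(R_0[r], R_i[r])` record whether the marked
entry lies before, inside or after the inner block. -/
theorem dendCirc_dendOfRRB (hη : IsLinearInM η) (h : RotaBaxterIdentity μ η T)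
    (hT : ∀ i m, m ∈ ℳ i → T m ∈ 𝒜 i) (N : ℕ) (r : Fin (N + 1)) (x : Fin (N + 1) → M) :
    dendCirc ℳ (dendOfRRB η T) N r x =
      (circ (prodGrading 𝒜 ℳ) 1 (liftOps μ η) (liftOps μ η) N (mark T r x)).2 := by
  unfold dendCirc circ
  rw [Prod.snd_sum]
  refine Finset.sum_congr rfl fun kl hkl => ?_
  have hN : kl.1 + kl.2 = N := Finset.HasAntidiagonal.mem_antidiagonal.mp hkl
  rw [Prod.snd_sum]
  refine Finset.sum_congr rfl fun i _ => ?_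
  change _ = η kl.1 _
  split_ifs with h1 h2
  · rw [dendOfRRB_apply, ← insertAt_mark_outside hη h (sgn_prodGrading_snd 1)
      (sgn_prodGrading_fst hT 1) hN (by omega) r]
    left
    exact ⟨h1, val_ofNat (by omega)⟩
  · rw [dendOfRRB_apply, ← insertAt_mark_inside (sgn_prodGrading_fst hT 1) hN i r]
    rw [val_ofNat (by omega)]
    omega
  · rw [dendOfRRB_apply, ← insertAt_mark_outside hη h (sgn_prodGrading_snd 1)
      (sgn_prodGrading_fst hT 1) hN (by omega) r]
    right
    refine ⟨by omega, ?_⟩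
    rw [val_ofNat (by omega)]
    omega

omit [DirectSum.Decomposition 𝒜] [DirectSum.Decomposition ℳ] in
theorem dendOfRRB_hasDegree {k : ℕ} (hd : HasDegree (prodGrading 𝒜 ℳ) ℳ 1 (η k))
    (hT : ∀ i m, m ∈ ℳ i → T m ∈ 𝒜 i) (r : Fin (k + 1)) : HasDegree ℳ ℳ 1 (dendOfRRB η T k r) := by
  intro d x hx
  rw [dendOfRRB_apply]
  refine hd d _ fun i => ?_
  simp only [mark]
  split_ifs
  · exact ⟨(𝒜 _).zero_mem, hx i⟩
  · exact ⟨hT _ _ (hx i), (ℳ _).zero_mem⟩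

theorem IsAInfBimodule.isDendInfAlgebra (hη : IsAInfBimodule 𝒜 ℳ μ η)
    (h : RotaBaxterIdentity μ η T) (hT : ∀ i m, m ∈ ℳ i → T m ∈ 𝒜 i) :
    IsDendInfAlgebra ℳ (dendOfRRB η T) where
  degree k r := dendOfRRB_hasDegree (hη.degree k) hT r
  identity N r x := by
    rw [dendCirc_dendOfRRB hη.linearInM h hT, hη.identity N _ (mark_oneFromM T r x)]
    rfl

theorem parityPart_mark (hT : ∀ i m, m ∈ ℳ i → T m ∈ 𝒜 i) {k : ℕ} (r : Fin k)
    (p : Fin k → ZMod 2) (u : Fin k → M) (i : Fin k) :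
    parityPart (prodGrading 𝒜 ℳ) (p i) (mark T r u i) =
      mark T r (fun i => parityPart ℳ (p i) (u i)) i := by
  rw [parityPart_prod]
  simp only [mark]
  split_ifs
  · rw [map_zero]
  · rw [map_zero, parityPart_map T hT]

/-- After permuting by `σ`, the mark of the last argument sits at `σ⁻¹ (Fin.last k)`, so both sides
agree summand by summand. `T` enters only through its compatibility with parities. -/
theorem preLieOfDend_dendOfRRB (hT : ∀ i m, m ∈ ℳ i → T m ∈ 𝒜 i) :
    preLieOfDend ℳ (dendOfRRB η T) = preLieOfRRBLie (symmetrize (prodGrading 𝒜 ℳ) η) T := by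
  funext k
  ext1 u
  rw [preLieOfRRBLie_eq, dendOfRRB_apply, symmetrize_apply, preLieOfDend, koszulSumMap_apply]
  refine Finset.sum_congr rfl fun p _ => Finset.sum_congr rfl fun σ _ => ?_
  congr 1
  dsimp only
  rw [dendOfRRB_apply, ← mark_comp_perm T _ (fun i => parityPart ℳ (p i) (u i))]
  congr 1
  funext i
  rw [parityPart_mark hT, Equiv.Perm.coe_inv, Equiv.apply_symm_apply]

theorem RotaBaxterIdentity.symmetrize (h : RotaBaxterIdentity μ η T)
    (hT : ∀ i m, m ∈ ℳ i → T m ∈ 𝒜 i) :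
    RotaBaxterIdentity (symmetrize 𝒜 μ) (symmetrize (prodGrading 𝒜 ℳ) η) T := by
  intro k u
  simp only [dendOfRRB_apply, symmetrize_apply, koszulSum, map_sum]
  symm
  rw [Finset.sum_comm]
  refine Finset.sum_congr rfl fun p _ => ?_
  rw [Finset.sum_comm]
  refine Finset.sum_congr rfl fun σ _ => ?_
  simp only [map_zsmul, ← Finset.smul_sum, parityPart_map T hT]
  congr 1
  -- The mark at position `r` of the permuted tuple is the mark at `σ r` of the original one.
  rw [h, map_sum, ← Equiv.sum_comp σ]
  refine Finset.sum_congr rfl fun r _ => ?_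
  rw [dendOfRRB_apply, ← mark_comp_perm T r (fun i => parityPart ℳ (p i) (u i))]
  simp only [parityPart_mark hT]

end Dend

/-! ### The pre-Lie identity from the module identity. -/

section PreLie

theorem map_insertAt_zero_of_eq_zero {K V W : Type*} [Field K] [AddCommGroup V] [Module K V]
    [AddCommGroup W] [Module K W] {k m N : ℕ} (h : k + m = N)
    (f : MultilinearMap K (fun _ : Fin (k + 1) => V) W)
    (g : MultilinearMap K (fun _ : Fin (m + 1) => V) V) {y : Fin (N + 1) → V} {i : Fin (N + 1)}
    (hi : y i = 0) : f (insertAt id k m N 0 g y) = 0 := by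
  rw [insertAt_zero]
  by_cases h1 : i.val ≤ m
  · refine f.map_coord_zero 0 ?_
    refine (if_pos rfl).trans ?_
    refine g.map_coord_zero ⟨i.val, by omega⟩ ?_
    exact (congrArg y ((ofNat_eq_iff (a := i) (by omega)).mpr rfl)).trans hi
  · refine f.map_coord_zero ⟨i.val - m, by omega⟩ ?_
    rw [if_neg (by simp only; omega)]
    exact (congrArg y ((ofNat_eq_iff (a := i) (by simp only; omega)).mpr (by simp only; omega))).trans hi

variable {K : Type*} [Field K] {A M : Type*} [AddCommGroup A] [Module K A]
  [AddCommGroup M] [Module K M]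
  {𝒜 : ℤ → Submodule K A} [DirectSum.Decomposition 𝒜]
  {ℳ : ℤ → Submodule K M} [DirectSum.Decomposition ℳ]
  {l : Ops K A A} {ρ : Ops K (A × M) M} {T : M →ₗ[K] A}

theorem dendOfRRB_comp_perm (hT : ∀ i m, m ∈ ℳ i → T m ∈ 𝒜 i) {k : ℕ}
    (hρ : IsParitySymm (prodGrading 𝒜 ℳ) (ρ k)) (σ : Equiv.Perm (Fin (k + 1))) (r : Fin (k + 1))
    (p : Fin (k + 1) → ZMod 2) (v : Fin (k + 1) → M) (hv : ∀ i, parityPart ℳ (p i) (v i) = v i) :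
    dendOfRRB ρ T k r (fun i => v (σ i)) = koszulSign σ p • dendOfRRB ρ T k (σ r) v := by
  rw [dendOfRRB_apply, dendOfRRB_apply, ← mark_comp_perm]
  exact hρ σ p _ fun i => by rw [parityPart_mark hT]; simp only [hv]

theorem preLieOfRRBLie_comp_perm (hT : ∀ i m, m ∈ ℳ i → T m ∈ 𝒜 i) {k : ℕ}
    (hρ : IsParitySymm (prodGrading 𝒜 ℳ) (ρ k)) (σ : Equiv.Perm (Fin (k + 1)))
    (hσ : σ (Fin.last k) = Fin.last k)
    (p : Fin (k + 1) → ZMod 2) (v : Fin (k + 1) → M) (hv : ∀ i, parityPart ℳ (p i) (v i) = v i) :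
    preLieOfRRBLie ρ T k (fun i => v (σ i)) = koszulSign σ p • preLieOfRRBLie ρ T k v := by
  rw [preLieOfRRBLie_eq, dendOfRRB_comp_perm hT hρ σ _ p v hv, hσ]

/-- The summand of the `L_∞[1]`-module identity at `(T u_1, …, T u_{n-1}, u_n)` belonging to `σ`. -/
def moduleTerm (l : Ops K A A) (ρ : Ops K (A × M) M) (T : M →ₗ[K] A) (k m N : ℕ)
    (q : Fin (N + 1) → ZMod 2) (u : Fin (N + 1) → M) (σ : Equiv.Perm (Fin (N + 1))) : M :=
  koszulSign σ q • ρ k (insertAt id k m N 0 (liftOpsMap l ρ m)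
    fun a => mark T (Fin.last N) u (σ a))

theorem moduleTerm_mul_swap (hT : ∀ i m, m ∈ ℳ i → T m ∈ 𝒜 i) {k m N : ℕ} (h : k + m = N)
    {n : ZMod 2} (hρ : IsParitySymm (prodGrading 𝒜 ℳ) (ρ k))
    (hl : HasParity (prodGrading 𝒜 ℳ) (prodGrading 𝒜 ℳ) n (liftOpsMap l ρ m))
    (hls : IsParitySymm (prodGrading 𝒜 ℳ) (liftOpsMap l ρ m))
    {q : Fin (N + 1) → ZMod 2} {u : Fin (N + 1) → M} (hu : ∀ i, parityPart ℳ (q i) (u i) = u i)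
    (i j : Fin (N + 1)) (hij : i.val ≤ m ↔ j.val ≤ m) (σ : Equiv.Perm (Fin (N + 1))) :
    moduleTerm l ρ T k m N q u (σ * Equiv.swap i j) = moduleTerm l ρ T k m N q u σ := by
  refine koszulSign_smul_insertAt_mul_swap (prodGrading 𝒜 ℳ) h (ρ k) hl i j ?_
    (fun i => by rw [parityPart_mark hT]; simp only [hu]) σ
  by_cases hi : i.val ≤ m
  · left
    exact ⟨⟨i.val, by omega⟩, ⟨j.val, by omega⟩, rfl, rfl, fun p v hv => hls _ p v hv⟩
  · right
    refine ⟨⟨i.val - m, by omega⟩, ⟨j.val - m, by omega⟩, ?_, ?_, ?_, ?_, fun p v hv => hρ _ p v hv⟩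
    all_goals simp only; omega

/-- Sort by the position `i` with `σ i = Fin.last N`. By invariance within the two blocks only the
block of `i` matters: `m + 1` inner positions, represented by `m`, and `k` outer ones, represented
by `N`. -/
theorem sum_moduleTerm_eq_of_block (hT : ∀ i m, m ∈ ℳ i → T m ∈ 𝒜 i) {k m N : ℕ} (h : k + m = N)
    {n : ZMod 2} (hρ : IsParitySymm (prodGrading 𝒜 ℳ) (ρ k))
    (hl : HasParity (prodGrading 𝒜 ℳ) (prodGrading 𝒜 ℳ) n (liftOpsMap l ρ m))
    (hls : IsParitySymm (prodGrading 𝒜 ℳ) (liftOpsMap l ρ m))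
    {q : Fin (N + 1) → ZMod 2} {u : Fin (N + 1) → M} (hu : ∀ i, parityPart ℳ (q i) (u i) = u i) :
    ∑ σ, moduleTerm l ρ T k m N q u σ =
      (m + 1) • (∑ σ : Equiv.Perm (Fin (N + 1)), if σ (Fin.ofNat (N + 1) m) = Fin.last N then
          moduleTerm l ρ T k m N q u σ else 0) +
        k • ∑ σ : Equiv.Perm (Fin (N + 1)), if σ (Fin.last N) = Fin.last N then
          moduleTerm l ρ T k m N q u σ else 0 := by
  have h1 : ∀ i j : Fin (N + 1), (i.val ≤ m ↔ j.val ≤ m) →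
      (∑ σ : Equiv.Perm (Fin (N + 1)), if σ i = Fin.last N then
        moduleTerm l ρ T k m N q u σ else 0) =
      ∑ σ : Equiv.Perm (Fin (N + 1)), if σ j = Fin.last N then
        moduleTerm l ρ T k m N q u σ else 0 := by
    intro i j hij
    rw [← Equiv.sum_comp (Equiv.mulRight (Equiv.swap i j))]
    refine Finset.sum_congr rfl fun σ _ => ?_
    rw [Equiv.coe_mulRight, moduleTerm_mul_swap hT h hρ hl hls hu i j hij, Equiv.Perm.mul_apply,
      Equiv.swap_apply_left]
  have h2 : ∀ σ : Equiv.Perm (Fin (N + 1)), moduleTerm l ρ T k m N q u σ =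
      ∑ i, if σ i = Fin.last N then moduleTerm l ρ T k m N q u σ else 0 := by
    intro σ
    rw [Finset.sum_eq_single (σ.symm (Fin.last N))]
    · simp
    · intro i _ hi
      exact if_neg fun hc => hi (by rw [← hc, Equiv.symm_apply_apply])
    · simp
  rw [Finset.sum_congr rfl fun σ _ => h2 σ, Finset.sum_comm]
  have h3 : ∀ i : Fin (N + 1), (∑ σ : Equiv.Perm (Fin (N + 1)), if σ i = Fin.last N then
      moduleTerm l ρ T k m N q u σ else 0) = if i.val < m + 1 then
        (∑ σ : Equiv.Perm (Fin (N + 1)), if σ (Fin.ofNat (N + 1) m) = Fin.last N then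
          moduleTerm l ρ T k m N q u σ else 0) else
        ∑ σ : Equiv.Perm (Fin (N + 1)), if σ (Fin.last N) = Fin.last N then
          moduleTerm l ρ T k m N q u σ else 0 := by
    intro i
    split_ifs with hi
    · exact h1 i _ (by rw [val_ofNat (by omega)]; omega)
    · exact h1 i _ (by rw [Fin.val_last]; omega)
  have c0 : (Finset.univ.filter fun i : Fin (N + 1) => i.val < m + 1).card = m + 1 := by
    rw [← Fintype.card_subtype]
    simpa using card_interval (n := N + 1) (s := 0) (t := m + 1) (by omega)
  have c1 : (Finset.univ.filter fun i : Fin (N + 1) => ¬ i.val < m + 1).card = k := by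
    rw [Finset.filter_not, Finset.card_sdiff_of_subset (Finset.filter_subset _ _), c0]
    simp
    omega
  rw [Finset.sum_congr rfl fun i _ => h3 i, Finset.sum_ite, Finset.sum_const, Finset.sum_const, c0, c1]

/-- Rotate the inner operation, which contains `u_n`, from the front to the last slot. Graded
symmetry of `ρ k` cancels the outer Koszul sign, leaving the sign `(-1)^{|x_{σ(1)}| + ⋯}` of the
pre-Lie identity. -/
theorem preLie_inner_last_eq_moduleTerm (hT : ∀ i m, m ∈ ℳ i → T m ∈ 𝒜 i) {k m N : ℕ} (h : k + m = N)
    (hρ : IsParitySymm (prodGrading 𝒜 ℳ) (ρ k))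
    (hl : HasParity (prodGrading 𝒜 ℳ) (prodGrading 𝒜 ℳ) ((1 : ℤ) : ZMod 2) (liftOpsMap l ρ m))
    {q : Fin (N + 1) → ZMod 2} {u : Fin (N + 1) → M} (hu : ∀ i, parityPart ℳ (q i) (u i) = u i)
    (σ : Equiv.Perm (Fin (N + 1))) (hσ : σ (Fin.ofNat (N + 1) m) = Fin.last N) :
    koszulSign (σ * blockRot h (Fin.last k)) q • preLieOfRRBLie ρ T k
      (insertAt (sgn ℳ 1) k m N k (preLieOfRRBLie ρ T m)
        fun a => u ((σ * blockRot h (Fin.last k)) a)) = moduleTerm l ρ T k m N q u σ := by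
  have hy : ∀ i, parityPart (prodGrading 𝒜 ℳ) (q (σ i)) (mark T (Fin.last N) u (σ i)) =
      mark T (Fin.last N) u (σ i) := fun i => by rw [parityPart_mark hT]; simp only [hu]
  have hlast : blockRot h (Fin.last k) (Fin.last N) = Fin.ofNat (N + 1) m := by
    apply Fin.ext
    rw [blockRot_val, val_ofNat (by omega)]
    simp only [Fin.val_last]
    split_ifs <;> omega
  have e1 := insertAt_mark_inside (μ := l) (η := ρ) (sgn_prodGrading_fst hT 1) h (Fin.last k) (Fin.last N)
    (Fin.last m) (by simpa using h) (fun a => u ((σ * blockRot h (Fin.last k)) a))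
  have e2 : (fun a => mark T (Fin.last N) u ((σ * blockRot h (Fin.last k)) a)) =
      mark T (Fin.last N) fun a => u ((σ * blockRot h (Fin.last k)) a) := by
    rw [← mark_comp_perm, Equiv.Perm.mul_apply, hlast, hσ]
  have e3 := map_insertAt_blockRot (prodGrading 𝒜 ℳ) h (Fin.last k) (n := 1) (ρ k)
    (g := liftOpsMap l ρ m) hy
  rw [hρ _ _ _ (insertAt_zero_parity (prodGrading 𝒜 ℳ) k m N hl hy), koszulSign_smul_smul] at e3
  rw [moduleTerm, ← e3, koszulSign_mul, mul_smul, preLieOfRRBLie_eq, dendOfRRB_apply]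
  congr 3
  refine Eq.trans ?_ (e1.symm.trans ?_)
  · rfl
  · rw [← e2]
    rfl

-- After the rotation, the remaining symmetries permute the positions `[0, k)` and `[k, N)`
-- separately and fix `N`; this accounts for `k! * m!` and for the shuffles of type `(j-1, i-1)`.
open Classical in
theorem sum_moduleTerm_inner (hT : ∀ i m, m ∈ ℳ i → T m ∈ 𝒜 i) {k m N : ℕ} (h : k + m = N)
    (hρ : IsParitySymm (prodGrading 𝒜 ℳ) (ρ k))
    (hl : HasParity (prodGrading 𝒜 ℳ) (prodGrading 𝒜 ℳ) ((1 : ℤ) : ZMod 2) (liftOpsMap l ρ m))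
    (hls : IsParitySymm (prodGrading 𝒜 ℳ) (liftOpsMap l ρ m))
    {q : Fin (N + 1) → ZMod 2} {u : Fin (N + 1) → M} (hu : ∀ i, parityPart ℳ (q i) (u i) = u i) :
    (∑ σ : Equiv.Perm (Fin (N + 1)), if σ (Fin.ofNat (N + 1) m) = Fin.last N then
        moduleTerm l ρ T k m N q u σ else 0) =
      (k.factorial * m.factorial) • ∑ σ : Equiv.Perm (Fin (N + 1)), koszulSign σ q •
        if σ (Fin.last N) = Fin.last N ∧
            ∀ i j : Fin (N + 1), i < j → j.val < N → (j.val < k ∨ k ≤ i.val) → σ i < σ j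
        then preLieOfRRBLie ρ T k (insertAt (sgn ℳ 1) k m N k (preLieOfRRBLie ρ T m)
          fun a => u (σ a)) else 0 := by
  set R := blockRot h (Fin.last k) with hR
  have hRv := blockRot_val h (Fin.last k)
  have hlast : R (Fin.last N) = Fin.ofNat (N + 1) m := by
    apply Fin.ext
    rw [hR, hRv, val_ofNat (by omega)]
    simp only [Fin.val_last]
    split_ifs <;> omega
  let HX : Equiv.Perm (Fin (N + 1)) → M := fun σ =>
    if σ (Fin.ofNat (N + 1) m) = Fin.last N then moduleTerm l ρ T k m N q u σ else 0
  let HB : Equiv.Perm (Fin (N + 1)) → M := fun σ =>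
    if σ (Fin.last N) = Fin.last N then koszulSign σ q • preLieOfRRBLie ρ T k
      (insertAt (sgn ℳ 1) k m N k (preLieOfRRBLie ρ T m) fun a => u (σ a)) else 0
  have hBX : ∀ σ, HB (σ * R) = HX σ := by
    intro σ
    simp only [HB, HX, Equiv.Perm.mul_apply, hlast]
    split_ifs with hσ
    · exact preLie_inner_last_eq_moduleTerm hT h hρ hl hu σ hσ
    · rfl
  have hBX' : ∀ σ, HB σ = HX (σ * R⁻¹) := fun σ => by rw [← hBX, inv_mul_cancel_right]
  have hXswap : ∀ (σ : Equiv.Perm (Fin (N + 1))) (i j : Fin (N + 1)),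
      (i.val < m ∧ j.val < m) ∨ (m < i.val ∧ m < j.val) → HX (σ * Equiv.swap i j) = HX σ := by
    intro σ i j hij
    simp only [HX]
    rw [moduleTerm_mul_swap hT h hρ hl hls hu i j (by omega), Equiv.Perm.mul_apply,
      Equiv.swap_apply_of_ne_of_ne]
    · rw [Ne, ofNat_eq_iff (by omega)]; omega
    · rw [Ne, ofNat_eq_iff (by omega)]; omega
  let b : Fin (N + 1) → Fin 3 := fun a => if a.val < k then 0 else if a.val < N then 1 else 2
  have hb : Monotone b := by
    intro i j hij
    have : i.val ≤ j.val := hij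
    simp only [b]
    split_ifs
    all_goals omega
  have hbv : ∀ i j, b i = b j ↔ (i.val < k ↔ j.val < k) ∧ (i.val < N ↔ j.val < N) := by
    intro i j
    simp only [b]
    split_ifs <;> simp [*] <;> omega
  have hsum : ∑ σ, HX σ = ∑ σ, HB σ := by
    rw [← Equiv.sum_comp (Equiv.mulRight R) HB]
    exact Finset.sum_congr rfl fun σ _ => (hBX σ).symm
  have c0 : Fintype.card {a // b a = 0} = k := by
    refine (Fintype.card_congr (Equiv.subtypeEquivRight fun a => ?_)).trans
      (card_interval (n := N + 1) (s := 0) (t := k) (by omega))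
    simp only [b]
    split_ifs <;> simp <;> omega
  have c1 : Fintype.card {a // b a = 1} = m := by
    refine ((Fintype.card_congr (Equiv.subtypeEquivRight fun a => ?_)).trans
      (card_interval (n := N + 1) (s := k) (t := N) (by omega))).trans (by omega)
    simp only [b]
    split_ifs <;> simp <;> omega
  have c2 : Fintype.card {a // b a = 2} = 1 := by
    refine ((Fintype.card_congr (Equiv.subtypeEquivRight fun a => ?_)).trans
      (card_interval (n := N + 1) (s := N) (t := N + 1) (by omega))).trans (by omega)
    simp only [b]
    split_ifs <;> simp <;> omega
  change ∑ σ, HX σ = _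
  rw [hsum, sum_perm_eq_smul_sum_shuffles hb]
  · rw [Fin.prod_univ_three, c0, c1, c2, Nat.factorial_one, mul_one]
    congr 1
    refine Finset.sum_congr rfl fun σ _ => ?_
    have : IncreasingOnBlocks b σ ↔
        ∀ i j : Fin (N + 1), i < j → j.val < N → (j.val < k ∨ k ≤ i.val) → σ i < σ j := by
      refine forall₃_congr fun i j hij => ?_
      have : i.val < j.val := hij
      rw [hbv, ← and_imp]
      refine imp_congr_left ?_
      omega
    simp only [HB, this, smul_ite, smul_zero, ← ite_and, and_comm]
  · intro σ i j hij hbij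
    -- Conjugation by `R` turns swaps in the rotated blocks into swaps among the outer positions
    -- above `m` or the inner positions below `m`.
    have e1 : Equiv.swap i j * R⁻¹ = R⁻¹ * Equiv.swap (R i) (R j) := by
      rw [mul_inv_eq_iff_eq_mul, mul_assoc, ← Equiv.mul_swap_eq_swap_mul, inv_mul_cancel_left]
    rw [hBX', hBX', mul_assoc, e1, ← mul_assoc]
    refine hXswap _ _ _ ?_
    rw [hbv] at hbij
    have hij' : i.val ≠ j.val := fun hc => hij (Fin.ext hc)
    rw [hR, hRv, hRv, Fin.val_last]
    split_ifs <;> omega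

-- Here `u_n` stays outside, so the inner operation becomes `T` of `m + 1` marked terms, all with
-- the same total sum. Each is invariant under `S_m × S_1 × S_k × S_1`, whence the `(i-1, 1,
-- j-2)`-shuffles; the singled-out position `m` is the distinguished inner argument.
open Classical in
theorem sum_moduleTerm_outer (hT : ∀ i m, m ∈ ℳ i → T m ∈ 𝒜 i)
    (hη : IsLinearInM ρ) (hRB : RotaBaxterIdentity l ρ T) {k m N : ℕ} (h : k + 1 + m = N)
    {n : ZMod 2} (hρ : ∀ k, IsParitySymm (prodGrading 𝒜 ℳ) (ρ k))
    (hd : HasParity ℳ ℳ n (preLieOfRRBLie ρ T m))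
    {q : Fin (N + 1) → ZMod 2} {u : Fin (N + 1) → M} (hu : ∀ i, parityPart ℳ (q i) (u i) = u i) :
    (∑ σ : Equiv.Perm (Fin (N + 1)), if σ (Fin.last N) = Fin.last N then
        moduleTerm l ρ T (k + 1) m N q u σ else 0) =
      ((m + 1) * (m.factorial * k.factorial)) • ∑ σ : Equiv.Perm (Fin (N + 1)), koszulSign σ q •
        if σ (Fin.last N) = Fin.last N ∧
            ∀ i j : Fin (N + 1), i < j → j.val < N → (j.val < m ∨ m < i.val) → σ i < σ j
        then preLieOfRRBLie ρ T (k + 1) (insertAt id (k + 1) m N 0 (preLieOfRRBLie ρ T m)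
          fun a => u (σ a)) else 0 := by
  let Y : Fin (m + 1) → Equiv.Perm (Fin (N + 1)) → M := fun t σ =>
    if σ (Fin.last N) = Fin.last N then koszulSign σ q • preLieOfRRBLie ρ T (k + 1)
      (insertAt id (k + 1) m N 0 (dendOfRRB ρ T m t) fun a => u (σ a)) else 0
  have h1 : ∀ σ : Equiv.Perm (Fin (N + 1)), (if σ (Fin.last N) = Fin.last N then
        moduleTerm l ρ T (k + 1) m N q u σ else 0) = ∑ t, Y t σ := by
    intro σ
    simp only [Y]
    split_ifs with hσ
    · rw [← Finset.smul_sum, moduleTerm]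
      congr 1
      have e1 := insertAt_mark_outside hη hRB (s := id) (s' := id) (fun _ => rfl) (fun _ => rfl) h
        (Nat.zero_le _) (Fin.last N) (Fin.last (k + 1)) (Or.inr ⟨by simp; omega, by simpa using h⟩)
        (fun a => u (σ a))
      have e2 : (fun a => mark T (Fin.last N) u (σ a)) = mark T (Fin.last N) fun a => u (σ a) := by
        rw [← mark_comp_perm, hσ]
      have e3 := map_insertAt_sum (preLieOfRRBLie ρ T (k + 1)) id m N 0 Finset.univ (fun _ => 1)
        (fun t => dendOfRRB ρ T m t) (fun a => u (σ a))
      simp only [one_smul, Fin.val_zero] at e3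
      rw [← e3, preLieOfRRBLie_eq, dendOfRRB_apply, ← e1, e2]
      rfl
    · simp
  have h2 : ∀ t, ∑ σ, Y t σ = ∑ σ, Y (Fin.last m) σ := by
    intro t
    -- Exchanging inner slots `t` and `m` moves the mark to the last inner slot, without touching
    -- the position of `u_n`.
    let E : Equiv.Perm (Fin (N + 1)) := extendPerm 0 (by omega) (Equiv.swap t (Fin.last m))
    have hE : E (Fin.last N) = Fin.last N :=
      extendPerm_apply_of_notMem 0 _ _ _ (Or.inr (by simp; omega))
    rw [← Equiv.sum_comp (Equiv.mulRight E)]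
    refine Finset.sum_congr rfl fun σ _ => ?_
    simp only [Y, Equiv.coe_mulRight, Equiv.Perm.mul_apply, hE]
    split_ifs with hσ
    · rw [koszulSign_mul, mul_smul]
      congr 1
      refine map_insertAt_inner ℳ h (preLieOfRRBLie ρ T (k + 1)) (dendOfRRB ρ T m t)
        (dendOfRRB ρ T m (Fin.last m)) _ ?_ fun a => hu (σ a)
      intro p v hv
      rw [dendOfRRB_comp_perm hT (hρ m) _ _ p v hv, Equiv.swap_apply_left]
    · rfl
  let b : Fin (N + 1) → Fin 4 := fun a =>
    if a.val < m then 0 else if a.val < m + 1 then 1 else if a.val < N then 2 else 3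
  have hb : Monotone b := by
    intro i j hij
    have : i.val ≤ j.val := hij
    simp only [b]
    split_ifs
    all_goals omega
  have hbv : ∀ i j, b i = b j ↔
      (i.val < m ↔ j.val < m) ∧ (i.val < m + 1 ↔ j.val < m + 1) ∧ (i.val < N ↔ j.val < N) := by
    intro i j
    simp only [b]
    split_ifs <;> simp [*] <;> omega
  have c0 : Fintype.card {a // b a = 0} = m := by
    refine (Fintype.card_congr (Equiv.subtypeEquivRight fun a => ?_)).trans
      (card_interval (n := N + 1) (s := 0) (t := m) (by omega))
    simp only [b]
    split_ifs <;> simp <;> omega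
  have c1 : Fintype.card {a // b a = 1} = 1 := by
    refine ((Fintype.card_congr (Equiv.subtypeEquivRight fun a => ?_)).trans
      (card_interval (n := N + 1) (s := m) (t := m + 1) (by omega))).trans (by omega)
    simp only [b]
    split_ifs <;> simp <;> omega
  have c2 : Fintype.card {a // b a = 2} = k := by
    refine ((Fintype.card_congr (Equiv.subtypeEquivRight fun a => ?_)).trans
      (card_interval (n := N + 1) (s := m + 1) (t := N) (by omega))).trans (by omega)
    simp only [b]
    split_ifs <;> simp <;> omega
  have c3 : Fintype.card {a // b a = 3} = 1 := by
    refine ((Fintype.card_congr (Equiv.subtypeEquivRight fun a => ?_)).trans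
      (card_interval (n := N + 1) (s := N) (t := N + 1) (by omega))).trans (by omega)
    simp only [b]
    split_ifs <;> simp <;> omega
  rw [Finset.sum_congr rfl fun σ _ => h1 σ, Finset.sum_comm, Finset.sum_congr rfl fun t _ => h2 t,
    Finset.sum_const, Finset.card_univ, Fintype.card_fin, mul_smul, sum_perm_eq_smul_sum_shuffles hb]
  · rw [Fin.prod_univ_four, c0, c1, c2, c3, Nat.factorial_one, mul_one, mul_one]
    congr 2
    refine Finset.sum_congr rfl fun σ _ => ?_
    have : IncreasingOnBlocks b σ ↔
        ∀ i j : Fin (N + 1), i < j → j.val < N → (j.val < m ∨ m < i.val) → σ i < σ j := by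
      refine forall₃_congr fun i j hij => ?_
      have : i.val < j.val := hij
      rw [hbv, ← and_imp]
      refine imp_congr_left ?_
      omega
    simp only [Y, this, smul_ite, smul_zero, ← ite_and, and_comm, preLieOfRRBLie_eq]
  · intro σ i j hij hbij
    rw [hbv] at hbij
    have hij' : i.val ≠ j.val := fun hc => hij (Fin.ext hc)
    have hlast : Equiv.swap i j (Fin.last N) = Fin.last N := by
      refine Equiv.swap_apply_of_ne_of_ne ?_ ?_ <;> rw [Ne, Fin.ext_iff, Fin.val_last] <;> omega
    simp only [Y, Equiv.Perm.mul_apply, hlast]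
    split_ifs
    · refine koszulSign_smul_insertAt_mul_swap ℳ h (preLieOfRRBLie ρ T (k + 1)) hd i j ?_ hu σ
      by_cases hi : i.val < m
      · left
        refine ⟨⟨i.val, by omega⟩, ⟨j.val, by omega⟩, rfl, rfl, fun p v hv =>
          preLieOfRRBLie_comp_perm hT (hρ m) _ ?_ p v hv⟩
        refine Equiv.swap_apply_of_ne_of_ne ?_ ?_ <;> rw [Ne, Fin.ext_iff, Fin.val_last] <;>
          simp only <;> omega
      · right
        refine ⟨⟨i.val - m, by omega⟩, ⟨j.val - m, by omega⟩, ?_, ?_, ?_, ?_, fun p v hv =>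
          preLieOfRRBLie_comp_perm hT (hρ (k + 1)) _ ?_ p v hv⟩
        · simp only; omega
        · simp only; omega
        · simp only; omega
        · simp only; omega
        refine Equiv.swap_apply_of_ne_of_ne ?_ ?_ <;> rw [Ne, Fin.ext_iff, Fin.val_last] <;>
          simp only <;> omega
    · rfl

/-- A strict operator on a module over an `L_∞[1]`-algebra induces a `pre-Lie_∞[1]`-algebra. -/
theorem preLieCirc_preLieOfRRBLie [CharZero K] (hT : ∀ i m, m ∈ ℳ i → T m ∈ 𝒜 i)
    (hη : IsLinearInM ρ) (hRB : RotaBaxterIdentity l ρ T)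
    (hl : ∀ k, HasParity (prodGrading 𝒜 ℳ) (prodGrading 𝒜 ℳ) ((1 : ℤ) : ZMod 2) (liftOpsMap l ρ k))
    (hls : ∀ k, IsParitySymm (prodGrading 𝒜 ℳ) (liftOpsMap l ρ k))
    (hρ : ∀ k, IsParitySymm (prodGrading 𝒜 ℳ) (ρ k))
    (hd : ∀ k, HasParity ℳ ℳ ((1 : ℤ) : ZMod 2) (preLieOfRRBLie ρ T k))
    (hid : ∀ N (x : Fin (N + 1) → A × M), OneFromM x →
      symmCirc (prodGrading 𝒜 ℳ) (liftOps l ρ) (liftOps l ρ) N x = 0)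
    (N : ℕ) (x : Fin (N + 1) → M) : preLieCirc ℳ (preLieOfRRBLie ρ T) N x = 0 := by
  have e1 : ∀ kl : ℕ × ℕ, ∀ a b : (Fin (N + 1) → ZMod 2) → M,
      ((if 1 ≤ kl.1 then ∑ p, a p else 0) + ∑ p, b p) = ∑ p, ((if 1 ≤ kl.1 then a p else 0) + b p) := by
    intro kl a b
    split_ifs <;> simp [Finset.sum_add_distrib]
  unfold preLieCirc koszulSum
  simp only [e1]
  -- One parity pattern at a time, so the entries may be taken of pure parity.
  rw [Finset.sum_comm]
  refine Finset.sum_eq_zero fun p _ => ?_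
  have hu : ∀ i, parityPart ℳ (p i) (parityPart ℳ (p i) (x i)) = parityPart ℳ (p i) (x i) :=
    fun i => by rw [parityPart_parityPart, if_pos rfl]
  set u : Fin (N + 1) → M := fun i => parityPart ℳ (p i) (x i) with hu_def
  have hy : ∀ i, parityPart (prodGrading 𝒜 ℳ) (p i) (mark T (Fin.last N) u i) =
      mark T (Fin.last N) u i := fun i => by rw [parityPart_mark hT]; simp only [u, hu]
  have h0 := congrArg Prod.snd (hid N _ (mark_oneFromM T (Fin.last N) u))
  unfold symmCirc at h0
  rw [Prod.snd_sum] at h0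
  refine Eq.trans (Finset.sum_congr rfl fun kl hkl => ?_) h0
  have h : kl.1 + kl.2 = N := Finset.HasAntidiagonal.mem_antidiagonal.mp hkl
  rw [koszulSum_of_parity _ _ _ p _ hy]
  · rw [Prod.snd_sum]
    -- With this factor the module identity becomes a sum over all permutations. It equals the inner
    -- coefficient `(m + 1) * k! * m!` and, for `k ≥ 1`, the outer one `k * (m + 1) * m! * (k -
    -- 1)!`.
    refine nsmul_left_cancel (K := K) (m := (kl.2 + 1).factorial * kl.1.factorial)
      (Nat.mul_ne_zero (Nat.factorial_ne_zero _) (Nat.factorial_ne_zero _)) ?_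
    have e2 := sum_perm_eq_sum_isShuffle (prodGrading 𝒜 ℳ) h (hρ kl.1) (hl kl.2) (hls kl.2) hy
    have e3 := sum_moduleTerm_eq_of_block hT h (hρ kl.1) (hl kl.2) (hls kl.2) hu
    have e4 := sum_moduleTerm_inner hT h (hρ kl.1) (hl kl.2) (hls kl.2) hu
    have e5 := e2.symm.trans e3
    refine Eq.trans ?_ (e5.symm.trans ?_)
    · rw [e4, smul_add, add_comm, smul_smul]
      congr 1
      · rw [Nat.factorial_succ]
        congr 1
        ring
      · rcases hk : kl.1 with _ | k
        -- Without outer arguments (`j = 1`) the first pre-Lie sum is absent, and the outer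
        -- contribution has coefficient zero.
        · simp
        · rw [hk] at h
          rw [if_pos (by omega), sum_moduleTerm_outer hT hη hRB h hρ (hd kl.2) hu, smul_smul,
            Nat.factorial_succ, Nat.factorial_succ]
          congr 1
          ring
    · congr 1
      refine Finset.sum_congr rfl fun σ _ => ?_
      rw [Prod.smul_snd]
      congr 1
      split_ifs <;> rfl
  · intro σ y i hi
    split_ifs
    · exact map_insertAt_zero_of_eq_zero h (liftOpsMap l ρ kl.1) (liftOpsMap l ρ kl.2) hi
    · rfl

end PreLie

end HomotopyRB

end

/-! ### Assembly of the diagram. -/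

theorem mainTheorem12 {K : Type*} [Field K] [CharZero K]
    {A M : Type*} [AddCommGroup A] [Module K A] [AddCommGroup M] [Module K M]
    (𝒜 : ℤ → Submodule K A) [DirectSum.Decomposition 𝒜]
    (ℳ : ℤ → Submodule K M) [DirectSum.Decomposition ℳ]
    (μ : Ops K A A) (η : Ops K (A × M) M) (T : M →ₗ[K] A)
    (hμ : IsAInfAlgebra 𝒜 μ) (hη : IsAInfBimodule 𝒜 ℳ μ η)
    (hT : IsStrictHomotopyRRB 𝒜 ℳ μ η T) :
    -- the upper and the right arrow
    IsDendInfAlgebra ℳ (dendOfRRB η T) ∧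
    IsPreLieInfAlgebra ℳ (preLieOfDend ℳ (dendOfRRB η T)) ∧
    -- the left and the lower arrow
    IsLInfAlgebra 𝒜 (symmetrize 𝒜 μ) ∧
    IsLInfModule 𝒜 ℳ (symmetrize 𝒜 μ) (symmetrize (prodGrading 𝒜 ℳ) η) ∧
    IsStrictHomotopyRRBLie 𝒜 ℳ (symmetrize 𝒜 μ) (symmetrize (prodGrading 𝒜 ℳ) η) T ∧
    IsPreLieInfAlgebra ℳ (preLieOfRRBLie (symmetrize (prodGrading 𝒜 ℳ) η) T) ∧
    -- the diagram commutes
    preLieOfDend ℳ (dendOfRRB η T) = preLieOfRRBLie (symmetrize (prodGrading 𝒜 ℳ) η) T := by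
  have hRB : RotaBaxterIdentity μ η T := hT.rotaBaxterIdentity hη.linearInM
  have hT' : ∀ i m, m ∈ ℳ i → T m ∈ 𝒜 i := hT.mem
  have hL := hμ.symmetrize
  have hM := hη.symmetrize hμ
  have hl : ∀ k, HasParity (prodGrading 𝒜 ℳ) (prodGrading 𝒜 ℳ) ((1 : ℤ) : ZMod 2)
      (liftOpsMap (symmetrize 𝒜 μ) (symmetrize (prodGrading 𝒜 ℳ) η) k) :=
    fun k => ((hL.degree k).liftOpsMap (hM.degree k)).hasParity
  have hls : ∀ k, IsParitySymm (prodGrading 𝒜 ℳ)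
      (liftOpsMap (symmetrize 𝒜 μ) (symmetrize (prodGrading 𝒜 ℳ) η) k) := by
    rw [← symmetrize_liftOpsMap]
    exact symmetrize_isParitySymm _ _
  have hρ := symmetrize_isParitySymm (prodGrading 𝒜 ℳ) η
  have hd : ∀ k, HasDegree ℳ ℳ 1 (preLieOfRRBLie (symmetrize (prodGrading 𝒜 ℳ) η) T k) :=
    fun k => dendOfRRB_hasDegree (hM.degree k) hT' (Fin.last k)
  have hpre : IsPreLieInfAlgebra ℳ (preLieOfRRBLie (symmetrize (prodGrading 𝒜 ℳ) η) T) :=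
    { degree := hd
      symm := fun k σ hσ d x hx => preLieOfRRBLie_comp_perm hT' (hρ k) σ hσ _ x
        fun i => parityPart_self_of_mem ℳ (hx i)
      identity := preLieCirc_preLieOfRRBLie hT' hM.linearInM (hRB.symmetrize hT') hl hls hρ
        (fun k => (hd k).hasParity) hM.identity }
  have heq := preLieOfDend_dendOfRRB (η := η) hT'
  -- The pre-Lie structure coming from the dendriform side is transported along the equality of the
  -- two families.
  exact ⟨hη.isDendInfAlgebra hRB hT', heq ▸ hpre, hL, hM,
    hRB.symm_maurerCartan hμ.degree hη.degree hη.linearInM hT.degree, hpre, heq⟩
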